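/- Let $n\ge 2$ and let $\sigma$ be the rotation invariant probability measure on the unit sphere $S^{n-1}\subset\mathbb R^n$, with $L^2=L^2(S^{n-1},\sigma)$ (real-valued functions). For $m\ge 0$ let $\mathcal H_m\subset L^2$ be the space of spherical harmonics of degree $m$, i.e. restrictions to $S^{n-1}$ of harmonic homogeneous polynomials of degree $m$. Let $\mathfrak M:L^2\to L^2$ be a bounded linear operator for which there are $\mu_m\in\mathbb R$, $m\ge 0$, with $\mathfrak M f=\mu_m f$ for all $f\in\mathcal H_m$, and assume that $\mathfrak M$ is a strong contraction, i.e. $\max_{m\ge 0}|\mu_m|<1$ and $\lim_{m\to\infty}\mu_m=0$. Then there exists $\delta\in(0,1)$ such that the following holds for every origin-symmetric convex body $K\subset\mathbb R^n$ (compact, convex, with nonempty interior, $K=-K$) and every $c\in(1-\delta,1+\delta)$. Let $h_K(\theta)=\max\{\langle x,\theta\rangle: x\in K\}$ and $\rho_K(\theta)=\max\{t>0: t\theta\in K\}$, $\theta\in S^{n-1}$, be the support and radial functions of $K$, and let $h_0$ and $r_0$ be the constant (degree $0$) terms of the spherical harmonic decompositions of $h_K$ and $\rho_K$. If $$1-\delta\le\rho_K\le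 1+\delta\quad\text{on } S^{n-1}\qquad\text{and}\qquad \|(h_K-h_0)-c\,\mathfrak M(\rho_K-r_0)\|_{L^2}\le\delta\,\|\rho_K-r_0\|_{L^2},$$ then $h_K$ and $\rho_K$ are constant and equal to the same $r>0$; that is, $K$ is the closed ball of radius $r$ centered at the origin. -/

import Mathlib

open MeasureTheory Filter Topology

/-- The Euclidean space `ℝⁿ`. -/
abbrev Euc (n : ℕ) : Type := EuclideanSpace ℝ (Fin n)

/-- The unit sphere `S^{n-1}` of `ℝⁿ`. -/
abbrev USphere (n : ℕ) : Type := Metric.sphere (0 : Euc n) 1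

/-- The rotation invariant surface measure on `S^{n-1}`, normalized to total mass `1`
(for `n ≥ 1`). -/
noncomputable def sphereMeasure (n : ℕ) : Measure (USphere n) :=
  ((volume : Measure (Euc n)).toSphere Set.univ)⁻¹ • (volume : Measure (Euc n)).toSphere

instance (n : ℕ) : IsFiniteMeasure (sphereMeasure n) := by
  constructor
  rw [sphereMeasure, Measure.smul_apply, smul_eq_mul]
  exact lt_of_le_of_lt (ENNReal.inv_mul_le_one _) ENNReal.one_lt_top

/-- The real Hilbert space `L²(S^{n-1})`. -/
abbrev SphereL2 (n : ℕ) : Type := Lp ℝ 2 (sphereMeasure n)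

/-- The class in `L²(S^{n-1})` of a continuous function on the sphere. -/
noncomputable def sphereToL2 (n : ℕ) : C(USphere n, ℝ) →L[ℝ] SphereL2 n :=
  ContinuousMap.toLp 2 (sphereMeasure n) ℝ

/-! ### Spherical harmonics -/

/-- The Laplacian `∑ᵢ ∂²p/∂xᵢ²` on polynomials in `n` variables. -/
noncomputable def polyLaplacian (n : ℕ) : MvPolynomial (Fin n) ℝ →ₗ[ℝ] MvPolynomial (Fin n) ℝ :=
  ∑ i : Fin n, (MvPolynomial.pderiv i).toLinearMap ∘ₗ (MvPolynomial.pderiv i).toLinearMap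

/-- The restriction of a polynomial function on `ℝⁿ` to the unit sphere. -/
noncomputable def polyRestrict (n : ℕ) : MvPolynomial (Fin n) ℝ →ₗ[ℝ] C(USphere n, ℝ) where
  toFun p := ⟨fun θ => MvPolynomial.eval (fun i => (θ : Euc n) i) p,
    (MvPolynomial.continuous_eval p).comp (by fun_prop)⟩
  map_add' p q := by ext θ; simp
  map_smul' a p := by ext θ; simp

/-- Harmonic homogeneous polynomials of degree `m` in `n` variables. -/
noncomputable def harmonicPoly (n m : ℕ) : Submodule ℝ (MvPolynomial (Fin n) ℝ) :=
  MvPolynomial.homogeneousSubmodule (Fin n) ℝ m ⊓ LinearMap.ker (polyLaplacian n)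

/-- The space `𝓗_m ⊆ L²(S^{n-1})` of spherical harmonics of degree `m`: the restrictions to the
sphere of the harmonic homogeneous polynomials of degree `m`. -/
noncomputable def sphHarmonic (n m : ℕ) : Submodule ℝ (SphereL2 n) :=
  (harmonicPoly n m).map ((sphereToL2 n).toLinearMap ∘ₗ polyRestrict n)

instance (n m : ℕ) : FiniteDimensional ℝ (sphHarmonic n m) := by
  have h0 : FiniteDimensional ℝ (MvPolynomial.homogeneousSubmodule (Fin n) ℝ m) :=
    Module.Finite.iff_fg.2 (MvPolynomial.homogeneousSubmodule_fg (Fin n) ℝ m)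
  have h1 : FiniteDimensional ℝ (harmonicPoly n m) :=
    Submodule.finiteDimensional_of_le (inf_le_left :
      harmonicPoly n m ≤ MvPolynomial.homogeneousSubmodule (Fin n) ℝ m)
  unfold sphHarmonic
  infer_instance

/-- The degree `m` term `f_m ∈ 𝓗_m` of the spherical harmonic decomposition of `f ∈ L²(S^{n-1})`:
the orthogonal projection of `f` to `𝓗_m`. The constant term of `f` is `harmonicTerm n 0 f`. -/
noncomputable def harmonicTerm (n m : ℕ) (f : SphereL2 n) : SphereL2 n :=
  (sphHarmonic n m).starProjection f

/-- A strong contraction: a bounded operator on `L²(S^{n-1})` that acts on every space `𝓗_m` as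
multiplication by a real number `μ m`, where `max_m |μ m| < 1` and `μ m → 0`. (As `μ m → 0`, the
maximum exists, so it is less than `1` exactly when every `|μ m|` is.) -/
def IsStrongContraction {n : ℕ} (M : SphereL2 n →L[ℝ] SphereL2 n) : Prop :=
  ∃ μ : ℕ → ℝ, (∀ m, ∀ f ∈ sphHarmonic n m, M f = μ m • f) ∧
    (∀ m, |μ m| < 1) ∧ Tendsto μ atTop (𝓝 0)

/-! ### Convex bodies -/

/-- An origin-symmetric convex body in `ℝⁿ`: a compact convex set with nonempty interior that is
symmetric about the origin. -/
structure SymConvexBody (n : ℕ) extends ConvexBody (Euc n) where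
  interior_nonempty : (interior carrier).Nonempty
  neg_mem : ∀ x ∈ carrier, -x ∈ carrier

namespace SymConvexBody

/-- The support function `h_K(θ) = max {⟨x, θ⟩ : x ∈ K}`. -/
noncomputable def supp {n : ℕ} (K : SymConvexBody n) (θ : USphere n) : ℝ :=
  sSup ((fun x : Euc n => inner ℝ x (θ : Euc n)) '' K.carrier)

/-- The radial function `ρ_K(θ) = max {t > 0 : t θ ∈ K}`. -/
noncomputable def radial {n : ℕ} (K : SymConvexBody n) (θ : USphere n) : ℝ :=
  sSup {t : ℝ | 0 < t ∧ t • (θ : Euc n) ∈ K.carrier}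

/-- The maximum that defines the support function is attained. -/
theorem isGreatest_supp {n : ℕ} (K : SymConvexBody n) (θ : USphere n) :
    IsGreatest ((fun x : Euc n => inner ℝ x (θ : Euc n)) '' K.carrier) (K.supp θ) :=
  (K.isCompact'.image (by fun_prop)).isGreatest_sSup (K.nonempty'.image _)

theorem continuous_supp {n : ℕ} (K : SymConvexBody n) : Continuous K.supp := by
  have h := K.isCompact'.continuous_sSup
    (f := fun (θ : USphere n) (x : Euc n) => inner ℝ x (θ : Euc n)) (by fun_prop)
  exact h

theorem carrier_mem_nhds {n : ℕ} (K : SymConvexBody n) : K.carrier ∈ 𝓝 (0 : Euc n) := by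
  obtain ⟨x, hx⟩ := K.interior_nonempty
  have h1 : -x ∈ K.carrier := K.neg_mem x (interior_subset hx)
  have h2 := K.convex'.combo_interior_self_mem_interior hx h1
    (a := 1 / 2) (b := 1 / 2) (by norm_num) (by norm_num) (by norm_num)
  have h3 : (1 / 2 : ℝ) • x + (1 / 2 : ℝ) • (-x) = 0 := by simp
  rw [h3] at h2
  exact mem_interior_iff_mem_nhds.1 h2

theorem gauge_pos {n : ℕ} (K : SymConvexBody n) (θ : USphere n) :
    0 < gauge K.carrier (θ : Euc n) := by
  have hθ : (θ : Euc n) ≠ 0 := ne_zero_of_mem_unit_sphere θ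
  exact (_root_.gauge_pos (absorbent_nhds_zero K.carrier_mem_nhds)
    ((NormedSpace.isVonNBounded_iff ℝ).2 K.isCompact'.isBounded)).2 hθ

theorem isGreatest_inv_gauge {n : ℕ} (K : SymConvexBody n) (θ : USphere n) :
    IsGreatest {t : ℝ | 0 < t ∧ t • (θ : Euc n) ∈ K.carrier}
      (gauge K.carrier (θ : Euc n))⁻¹ := by
  have hg := K.gauge_pos θ
  have key : ∀ t : ℝ, 0 < t →
      (t • (θ : Euc n) ∈ K.carrier ↔ t * gauge K.carrier (θ : Euc n) ≤ 1) := by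
    intro t ht
    have h := gauge_le_one_iff_mem_closure K.convex' K.carrier_mem_nhds
      (x := t • (θ : Euc n))
    rw [K.isCompact'.isClosed.closure_eq, gauge_smul_of_nonneg ht.le, smul_eq_mul] at h
    exact h.symm
  refine ⟨⟨inv_pos.2 hg, (key _ (inv_pos.2 hg)).2 (inv_mul_cancel₀ hg.ne').le⟩, ?_⟩
  rintro t ⟨ht, htK⟩
  rw [← one_div, le_div_iff₀ hg]
  exact (key t ht).1 htK

theorem radial_eq_inv_gauge {n : ℕ} (K : SymConvexBody n) (θ : USphere n) :
    K.radial θ = (gauge K.carrier (θ : Euc n))⁻¹ :=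
  (K.isGreatest_inv_gauge θ).csSup_eq

/-- The maximum that defines the radial function is attained. -/
theorem isGreatest_radial {n : ℕ} (K : SymConvexBody n) (θ : USphere n) :
    IsGreatest {t : ℝ | 0 < t ∧ t • (θ : Euc n) ∈ K.carrier} (K.radial θ) := by
  rw [K.radial_eq_inv_gauge θ]
  exact K.isGreatest_inv_gauge θ

theorem continuous_radial {n : ℕ} (K : SymConvexBody n) : Continuous K.radial := by
  have h : K.radial = fun θ : USphere n => (gauge K.carrier (θ : Euc n))⁻¹ :=
    funext K.radial_eq_inv_gauge
  rw [h]
  exact ((continuous_gauge K.convex' K.carrier_mem_nhds).comp continuous_subtype_val).inv₀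
    fun θ => (K.gauge_pos θ).ne'

/-- The support function as an element of `L²(S^{n-1})`. -/
noncomputable def suppL2 {n : ℕ} (K : SymConvexBody n) : SphereL2 n :=
  sphereToL2 n ⟨K.supp, K.continuous_supp⟩

/-- The radial function as an element of `L²(S^{n-1})`. -/
noncomputable def radialL2 {n : ℕ} (K : SymConvexBody n) : SphereL2 n :=
  sphereToL2 n ⟨K.radial, K.continuous_radial⟩

end SymConvexBody

/-! Write ε for the L² distance from `ρ_K` to its mean. The aim is an inequality ε ≤ (something <
1)·ε, which forces ε = 0. Since the multipliers tend to 0, `𝔐(ρ_K - r₀)` is within ηε of a sum of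
harmonics of boundedly many degrees, of norm at most qε with q < 1. After multiplication by c this
is a function g in a fixed finite-dimensional space, so g is bounded and Lipschitz with constant λ =
O(ε), and the hypothesis says that `h_K` is L²-close to κ + g, where κ = `h₀`.

The heart is `exists_norm_radial_sub_le`: closeness passes from `h_K` to `ρ_K`, that is ‖ρ - κ - g‖
≤ C‖h - κ - g‖ + 288λ². One side is the pointwise bound ρ ≤ h. For the other, suppose that ρ lies a
≫ λ² below κ + g at φ. The supporting hyperplane at the boundary point over φ has a normal θ at
which e = h - κ - g is at most -E, where E ≥ a/4 and |θ - φ|² ≤ 8E (`exists_supp_dip`). Sublinearity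
of h prevents so deep a dip from being isolated: for small v, e is of size at least E/16 at θ + v or
at θ + 2v (`large_or_large_of_dip`). Hence |e| ≳ E on a fixed proportion of a ball of radius about
√E near φ. A Fubini count at each dyadic scale turns this into an L² bound
(`exists_norm_le_of_density`).

Finally ε ≤ ‖ρ - κ‖ ≤ ‖ρ - κ - g‖ + ‖g‖. The first term is a small multiple of ε plus O(ε²), the
second at most cqε. For small δ the total is strictly less than ε unless ε = 0; then ρ is constant
and K is a ball.

The harmonic analysis needed is orthogonality of different degrees and completeness. Orthogonality
comes from Gaussian integration by parts on `ℝⁿ` and polar coordinates, so no calculus on the sphere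
is required. -/

/-! ### Polynomial functions on Euclidean space and Gaussian integrals -/

/-- The polynomial function on `ℝⁿ` defined by `p`. -/
noncomputable def polyFun {n : ℕ} (p : MvPolynomial (Fin n) ℝ) (x : Euc n) : ℝ :=
  MvPolynomial.eval (fun i => x i) p

section polyFun

variable {n : ℕ}

@[simp] theorem polyFun_add (p q : MvPolynomial (Fin n) ℝ) (x : Euc n) :
    polyFun (p + q) x = polyFun p x + polyFun q x := by simp [polyFun]

@[simp] theorem polyFun_mul (p q : MvPolynomial (Fin n) ℝ) (x : Euc n) :
    polyFun (p * q) x = polyFun p x * polyFun q x := by simp [polyFun]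

@[simp] theorem polyFun_X (i : Fin n) (x : Euc n) :
    polyFun (MvPolynomial.X i) x = x i := by simp [polyFun]

@[simp] theorem polyFun_C (a : ℝ) (x : Euc n) :
    polyFun (MvPolynomial.C a) x = a := by simp [polyFun]

@[simp] theorem polyFun_one (x : Euc n) : polyFun (1 : MvPolynomial (Fin n) ℝ) x = 1 := by
  simp [polyFun]

@[simp] theorem polyFun_zero (x : Euc n) : polyFun (0 : MvPolynomial (Fin n) ℝ) x = 0 := by
  simp [polyFun]

theorem polyFun_sum {ι : Type*} (s : Finset ι) (p : ι → MvPolynomial (Fin n) ℝ) (x : Euc n) :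
    polyFun (∑ i ∈ s, p i) x = ∑ i ∈ s, polyFun (p i) x := by simp [polyFun]

theorem continuous_polyFun (p : MvPolynomial (Fin n) ℝ) : Continuous (polyFun p) :=
  (MvPolynomial.continuous_eval p).comp (by fun_prop)

theorem polyFun_smul {p : MvPolynomial (Fin n) ℝ} {m : ℕ} (hp : p.IsHomogeneous m) (t : ℝ)
    (x : Euc n) : polyFun p (t • x) = t ^ m * polyFun p x := by
  rw [polyFun, polyFun, MvPolynomial.eval_eq', MvPolynomial.eval_eq', Finset.mul_sum]
  refine Finset.sum_congr rfl fun d hd => ?_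
  have h : ∑ i, d i = m := by
    have := hp (MvPolynomial.mem_support_iff.1 hd)
    rw [Finsupp.weight_apply, Finsupp.sum_fintype _ _ (by simp)] at this
    simpa using this
  simp only [PiLp.smul_apply, smul_eq_mul, mul_pow, Finset.prod_mul_distrib,
    Finset.prod_pow_eq_pow_sum, h]
  ring

theorem eq_zero_of_polyFun_eq_zero {p : MvPolynomial (Fin n) ℝ} (h : ∀ x, polyFun p x = 0) :
    p = 0 := by
  refine MvPolynomial.funext fun x => ?_
  have := h (WithLp.toLp 2 x)
  simpa [polyFun] using this

theorem hasFDerivAt_polyFun (p : MvPolynomial (Fin n) ℝ) (x : Euc n) :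
    HasFDerivAt (polyFun p)
      (∑ i, polyFun (MvPolynomial.pderiv i p) x • (EuclideanSpace.proj i : Euc n →L[ℝ] ℝ)) x := by
  induction p using MvPolynomial.induction_on with
  | C a =>
    have : polyFun (MvPolynomial.C a : MvPolynomial (Fin n) ℝ) = fun _ => a := by
      ext y; simp
    rw [this]
    exact (hasFDerivAt_const a x).congr_fderiv (by simp)
  | add p q hp hq =>
    have : polyFun (p + q) = fun y => polyFun p y + polyFun q y := by
      ext y; simp
    rw [this]
    refine (hp.fun_add hq).congr_fderiv ?_
    simp [add_smul, Finset.sum_add_distrib]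
  | mul_X p i hp =>
    have : polyFun (p * MvPolynomial.X i) =
        fun y => polyFun p y * (EuclideanSpace.proj i : Euc n →L[ℝ] ℝ) y := by
      ext y; simp
    rw [this]
    refine (hp.fun_mul ((EuclideanSpace.proj i : Euc n →L[ℝ] ℝ).hasFDerivAt (x := x))).congr_fderiv ?_
    ext v
    have h1 (j : Fin n) : polyFun (MvPolynomial.pderiv j (p * MvPolynomial.X i)) x =
        polyFun p x * (if j = i then 1 else 0) + x i * polyFun (MvPolynomial.pderiv j p) x := by
      rw [Derivation.leibniz, MvPolynomial.pderiv_X, Pi.single_apply, polyFun_add, smul_eq_mul,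
        smul_eq_mul, polyFun_mul, polyFun_mul, polyFun_X]
      rcases eq_or_ne i j with rfl | h
      · simp
      · simp [h, h.symm]
    simp only [h1]
    simp [add_mul, Finset.sum_add_distrib, Finset.mul_sum, mul_assoc]

theorem fderiv_polyFun_single (p : MvPolynomial (Fin n) ℝ) (i : Fin n) (x : Euc n) :
    fderiv ℝ (polyFun p) x (EuclideanSpace.single i 1) = polyFun (MvPolynomial.pderiv i p) x := by
  rw [(hasFDerivAt_polyFun p x).fderiv]
  simp

/-- An exponential bound, unlike a power bound, is stable under multiplication by a coordinate with
no case distinction near the origin, and the Gaussian still dominates it. -/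
theorem abs_polyFun_le (p : MvPolynomial (Fin n) ℝ) :
    ∃ (C : ℝ) (k : ℕ), 0 ≤ C ∧ ∀ x, |polyFun p x| ≤ C * Real.exp (k * ‖x‖) := by
  induction p using MvPolynomial.induction_on with
  | C a => exact ⟨|a|, 0, abs_nonneg a, fun x => by simp⟩
  | add p q hp hq =>
    obtain ⟨C, k, hC, h⟩ := hp
    obtain ⟨C', k', hC', h'⟩ := hq
    refine ⟨C + C', k + k', by positivity, fun x => ?_⟩
    rw [polyFun_add, add_mul]
    refine (abs_add_le _ _).trans (add_le_add ((h x).trans ?_) ((h' x).trans ?_)) <;>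
    · gcongr; nlinarith [norm_nonneg x, Nat.cast_nonneg (α := ℝ) k, Nat.cast_nonneg (α := ℝ) k']
  | mul_X p i hp =>
    obtain ⟨C, k, hC, h⟩ := hp
    refine ⟨C, k + 1, hC, fun x => ?_⟩
    rw [polyFun_mul, polyFun_X, abs_mul]
    have h1 : |x i| ≤ Real.exp ‖x‖ := by
      have := PiLp.norm_apply_le x i
      rw [Real.norm_eq_abs] at this
      linarith [Real.add_one_le_exp ‖x‖]
    calc |polyFun p x| * |x i| ≤ (C * Real.exp (k * ‖x‖)) * Real.exp ‖x‖ := by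
          gcongr; exact h x
      _ = C * Real.exp ((k + 1 : ℕ) * ‖x‖) := by
          rw [mul_assoc, ← Real.exp_add]; push_cast; ring_nf

/-- The Gaussian weight. -/
noncomputable def gaussWeight (x : Euc n) : ℝ := Real.exp (-(‖x‖ ^ 2) / 2)

theorem continuous_gaussWeight : Continuous (gaussWeight (n := n)) := by
  unfold gaussWeight; fun_prop

theorem integrable_exp_neg_mul_norm_sq {b : ℝ} (hb : 0 < b) :
    Integrable fun x : Euc n => Real.exp (-b * ‖x‖ ^ 2) := by
  have h := (GaussianFourier.integrable_cexp_neg_mul_sq_norm_add (b := (b : ℂ)) (V := Euc n)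
    (by simpa) 0 0).norm
  refine h.congr (.of_forall fun x => ?_)
  simp only [zero_mul, add_zero]
  rw [Complex.norm_exp]
  norm_cast

theorem integrable_polyFun_mul_gaussWeight (p : MvPolynomial (Fin n) ℝ) :
    Integrable fun x : Euc n => polyFun p x * gaussWeight x := by
  obtain ⟨C, k, hC, h⟩ := abs_polyFun_le p
  refine ((integrable_exp_neg_mul_norm_sq (n := n) (b := 1 / 4) (by norm_num)).const_mul
    (C * Real.exp (k ^ 2))).mono'
    ((continuous_polyFun p).mul continuous_gaussWeight).aestronglyMeasurable (.of_forall fun x => ?_)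
  rw [Real.norm_eq_abs, abs_mul, gaussWeight, Real.abs_exp]
  calc |polyFun p x| * Real.exp (-(‖x‖ ^ 2) / 2)
      ≤ (C * Real.exp (k * ‖x‖)) * Real.exp (-(‖x‖ ^ 2) / 2) := by gcongr; exact h x
    _ = C * Real.exp (k * ‖x‖ + -(‖x‖ ^ 2) / 2) := by rw [mul_assoc, ← Real.exp_add]
    _ ≤ C * Real.exp (k ^ 2 + -(1 / 4) * ‖x‖ ^ 2) := by
        gcongr C * Real.exp ?_
        nlinarith [sq_nonneg ((k : ℝ) - ‖x‖ / 2)]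
    _ = _ := by rw [Real.exp_add, mul_assoc]

/-- The Gaussian integral of a polynomial. -/
noncomputable def gaussInt (p : MvPolynomial (Fin n) ℝ) : ℝ :=
  ∫ x : Euc n, polyFun p x * gaussWeight x

theorem gaussInt_add (p q : MvPolynomial (Fin n) ℝ) :
    gaussInt (p + q) = gaussInt p + gaussInt q := by
  unfold gaussInt
  rw [← integral_add (integrable_polyFun_mul_gaussWeight p) (integrable_polyFun_mul_gaussWeight q)]
  simp [add_mul]

theorem gaussInt_C_mul (a : ℝ) (p : MvPolynomial (Fin n) ℝ) :
    gaussInt (MvPolynomial.C a * p) = a * gaussInt p := by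
  unfold gaussInt
  rw [← integral_const_mul]
  simp [mul_assoc]

theorem gaussInt_sum {ι : Type*} (s : Finset ι) (p : ι → MvPolynomial (Fin n) ℝ) :
    gaussInt (∑ i ∈ s, p i) = ∑ i ∈ s, gaussInt (p i) := by
  unfold gaussInt
  rw [← integral_finsetSum _ fun i _ => integrable_polyFun_mul_gaussWeight (p i)]
  simp [polyFun_sum, Finset.sum_mul]

theorem hasFDerivAt_gaussWeight (x : Euc n) :
    HasFDerivAt gaussWeight (-(gaussWeight x) • innerSL ℝ x) x := by
  have h := ((hasStrictFDerivAt_norm_sq x).hasFDerivAt.neg.mul_const (2⁻¹ : ℝ)).exp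
  refine (h.congr_fderiv ?_).congr_of_eventuallyEq (.of_forall fun y => ?_)
  · ext v
    simp [gaussWeight, div_eq_mul_inv]
  · simp [gaussWeight, div_eq_mul_inv]

/-- Integration by parts: the i-th derivative of the weight is -xᵢ times the weight. -/
theorem gaussInt_pderiv (p : MvPolynomial (Fin n) ℝ) (i : Fin n) :
    gaussInt (MvPolynomial.pderiv i p) = gaussInt (MvPolynomial.X i * p) := by
  have hw : ∀ x : Euc n, fderiv ℝ gaussWeight x (EuclideanSpace.single i 1) =
      -(x i * gaussWeight x) := by
    intro x
    rw [(hasFDerivAt_gaussWeight x).fderiv]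
    simp [EuclideanSpace.inner_single_right, mul_comm]
  have h := integral_mul_fderiv_eq_neg_fderiv_mul_of_integrable (μ := (volume : Measure (Euc n)))
    (f := polyFun p) (g := gaussWeight) (v := EuclideanSpace.single i 1)
    (by simpa only [fderiv_polyFun_single] using integrable_polyFun_mul_gaussWeight _)
    (by
      simp only [hw]
      refine (integrable_polyFun_mul_gaussWeight (MvPolynomial.X i * p)).neg.congr
        (.of_forall fun x => ?_)
      simp; ring)
    (integrable_polyFun_mul_gaussWeight p)
    (fun x _ => (hasFDerivAt_polyFun p x).differentiableAt)
    (fun x _ => (hasFDerivAt_gaussWeight x).differentiableAt)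
  simp only [hw, fderiv_polyFun_single] at h
  have h2 : ∫ x : Euc n, polyFun p x * -(x i * gaussWeight x) =
      - ∫ x : Euc n, polyFun (MvPolynomial.X i * p) x * gaussWeight x := by
    rw [← integral_neg]
    congr 1; ext x; simp; ring
  rw [h2] at h
  exact (neg_injective h).symm

theorem polyLaplacian_apply (p : MvPolynomial (Fin n) ℝ) :
    polyLaplacian n p = ∑ i, MvPolynomial.pderiv i (MvPolynomial.pderiv i p) := by
  simp [polyLaplacian]

/-- Integrate the divergence of q∇p by parts; the weight produces Σ xᵢ ∂ᵢp, which is mp by Euler's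
identity. -/
theorem gaussInt_laplacian_mul {p : MvPolynomial (Fin n) ℝ} {m : ℕ} (hp : p.IsHomogeneous m)
    (q : MvPolynomial (Fin n) ℝ) :
    gaussInt (polyLaplacian n p * q) = m * gaussInt (p * q) -
      gaussInt (∑ i, MvPolynomial.pderiv i p * MvPolynomial.pderiv i q) := by
  have h1 : polyLaplacian n p * q = ∑ i, MvPolynomial.pderiv i (MvPolynomial.pderiv i p * q) +
      MvPolynomial.C (-1) * ∑ i, MvPolynomial.pderiv i p * MvPolynomial.pderiv i q := by
    rw [polyLaplacian_apply, Finset.sum_mul]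
    simp [Derivation.leibniz, Finset.sum_add_distrib, mul_comm]
  have h2 : (MvPolynomial.C (m : ℝ)) * (p * q) =
      ∑ i, MvPolynomial.X i * (MvPolynomial.pderiv i p * q) := by
    have h := hp.sum_X_mul_pderiv
    rw [← mul_assoc]
    simp only [← mul_assoc]
    rw [← Finset.sum_mul, h]
    simp
  rw [h1, gaussInt_add, gaussInt_C_mul, gaussInt_sum, ← gaussInt_C_mul (m : ℝ), h2, gaussInt_sum]
  simp only [gaussInt_pderiv, gaussInt_sum]
  ring

/-- The gradient term of `gaussInt_laplacian_mul` is symmetric in p and q, so exchanging their roles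
and subtracting leaves (m - k) times the integral of pq. -/
theorem gaussInt_mul_eq_zero {p q : MvPolynomial (Fin n) ℝ} {m k : ℕ}
    (hp : p ∈ harmonicPoly n m) (hq : q ∈ harmonicPoly n k) (hmk : m ≠ k) :
    gaussInt (p * q) = 0 := by
  obtain ⟨hp1, hp2⟩ := hp
  obtain ⟨hq1, hq2⟩ := hq
  have h1 := gaussInt_laplacian_mul hp1 q
  have h2 := gaussInt_laplacian_mul hq1 p
  rw [LinearMap.mem_ker.1 hp2, zero_mul] at h1
  rw [LinearMap.mem_ker.1 hq2, zero_mul, mul_comm q p] at h2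
  simp only [mul_comm (MvPolynomial.pderiv _ q)] at h2
  have h3 : ((m : ℝ) - k) * gaussInt (p * q) = 0 := by linarith
  exact (mul_eq_zero.1 h3).resolve_left (sub_ne_zero.2 (by exact_mod_cast hmk))

end polyFun

/-! ### Polar coordinates -/

section polar

variable {n : ℕ}

theorem lintegral_eq_lintegral_polar [Nontrivial (Euc n)] (f : Euc n → ENNReal) :
    ∫⁻ x, f x = ∫⁻ z : USphere n × Set.Ioi (0 : ℝ), f ((z.2 : ℝ) • (z.1 : Euc n))
      ∂((volume : Measure (Euc n)).toSphere.prod (Measure.volumeIoiPow (n - 1))) := by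
  have h := (volume : Measure (Euc n)).measurePreserving_homeomorphUnitSphereProd
  rw [finrank_euclideanSpace_fin] at h
  rw [← h.lintegral_comp_emb (Homeomorph.measurableEmbedding _)]
  have h1 : ∀ x : ({0}ᶜ : Set (Euc n)), f (((homeomorphUnitSphereProd (Euc n) x).2 : ℝ) •
      ((homeomorphUnitSphereProd (Euc n) x).1 : Euc n)) = f x := by
    intro x
    congr 1
    simpa using smul_inv_smul₀ (norm_ne_zero_iff.2 x.2) (x : Euc n)
  simp only [h1]
  rw [lintegral_subtype_comap (measurableSet_singleton _).compl f, restrict_compl_singleton]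

theorem integral_eq_integral_polar [Nontrivial (Euc n)] (f : Euc n → ℝ) :
    ∫ x, f x = ∫ z : USphere n × Set.Ioi (0 : ℝ), f ((z.2 : ℝ) • (z.1 : Euc n))
      ∂((volume : Measure (Euc n)).toSphere.prod (Measure.volumeIoiPow (n - 1))) := by
  have h := (volume : Measure (Euc n)).measurePreserving_homeomorphUnitSphereProd
  rw [finrank_euclideanSpace_fin] at h
  rw [← h.integral_comp (Homeomorph.measurableEmbedding _)]
  have h1 : ∀ x : ({0}ᶜ : Set (Euc n)), f (((homeomorphUnitSphereProd (Euc n) x).2 : ℝ) •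
      ((homeomorphUnitSphereProd (Euc n) x).1 : Euc n)) = f x := by
    intro x
    congr 1
    simpa using smul_inv_smul₀ (norm_ne_zero_iff.2 x.2) (x : Euc n)
  simp only [h1]
  rw [integral_subtype_comap (measurableSet_singleton _).compl f, restrict_compl_singleton]

theorem norm_smul_sphere (z : USphere n × Set.Ioi (0 : ℝ)) :
    ‖(z.2 : ℝ) • (z.1 : Euc n)‖ = z.2 := by
  rw [norm_smul, norm_eq_of_mem_sphere, mul_one, Real.norm_of_nonneg (le_of_lt z.2.2)]

/-- The radial moments of the Gaussian weight do not vanish. -/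
theorem integral_gaussian_moment_ne_zero [Nontrivial (Euc n)] (d : ℕ) :
    ∫ r : Set.Ioi (0 : ℝ), (r : ℝ) ^ d * Real.exp (-((r : ℝ) ^ 2) / 2)
      ∂(Measure.volumeIoiPow (n - 1)) ≠ 0 := by
  intro h0
  -- The integral of a radial function is evaluated twice, by the polar decomposition and by the
  -- classical one-dimensional formula, whose value is a positive Gamma factor.
  have h1 := integral_fun_norm_addHaar (volume : Measure (Euc n))
    (fun r : ℝ => r ^ d * Real.exp (-(r ^ 2) / 2))
  rw [integral_eq_integral_polar (fun x : Euc n => ‖x‖ ^ d * Real.exp (-(‖x‖ ^ 2) / 2))] at h1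
  simp only [norm_smul_sphere] at h1
  rw [integral_fun_snd (fun r : Set.Ioi (0 : ℝ) => (r : ℝ) ^ d * Real.exp (-((r : ℝ) ^ 2) / 2)),
    h0, smul_zero, finrank_euclideanSpace_fin] at h1
  have h2 : ∫ y in Set.Ioi (0 : ℝ), y ^ (n - 1) • (y ^ d * Real.exp (-(y ^ 2) / 2)) =
      ∫ y in Set.Ioi (0 : ℝ), y ^ ((n - 1 + d : ℕ) : ℝ) * Real.exp (-(1 / 2) * y ^ (2 : ℝ)) := by
    refine integral_congr_ae (.of_forall fun y => ?_)
    simp only [smul_eq_mul, Real.rpow_natCast, Real.rpow_two, pow_add]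
    rw [← mul_assoc]
    congr 2; ring
  have h3 : 0 < ∫ y in Set.Ioi (0 : ℝ), y ^ (n - 1) • (y ^ d * Real.exp (-(y ^ 2) / 2)) := by
    have h4 : (-1 : ℝ) < ((n - 1 + d : ℕ) : ℝ) := by
      have := Nat.cast_nonneg (α := ℝ) (n - 1 + d); linarith
    rw [h2, integral_rpow_mul_exp_neg_mul_rpow (by norm_num) h4 (by norm_num)]
    have : 0 < (((n - 1 + d : ℕ) : ℝ) + 1) / 2 := by linarith
    have := Real.Gamma_pos_of_pos this
    positivity
  have hn : n ≠ 0 := by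
    rintro rfl
    exact not_subsingleton (Euc 0) inferInstance
  have h5 : 0 < (volume : Measure (Euc n)).real (Metric.ball 0 1) :=
    ENNReal.toReal_pos (Metric.measure_ball_pos _ _ one_pos).ne' measure_ball_lt_top.ne
  have h6 : (0 : ℝ) < n := by positivity
  simp only [nsmul_eq_mul] at h1
  rw [smul_eq_mul] at h1
  exact (mul_pos h6 (mul_pos h5 h3)).ne h1

/-- Homogeneity separates the variables in polar coordinates. As the radial factor is nonzero, a
vanishing Gaussian integral gives a vanishing integral over the sphere. -/
theorem gaussInt_eq_mul_integral_sphere [Nontrivial (Euc n)] {p : MvPolynomial (Fin n) ℝ} {d : ℕ}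
    (hp : p.IsHomogeneous d) :
    gaussInt p = (∫ θ : USphere n, polyFun p θ ∂(volume : Measure (Euc n)).toSphere) *
      ∫ r : Set.Ioi (0 : ℝ), (r : ℝ) ^ d * Real.exp (-((r : ℝ) ^ 2) / 2)
        ∂(Measure.volumeIoiPow (n - 1)) := by
  rw [gaussInt, integral_eq_integral_polar, ← integral_prod_mul]
  congr 1
  ext z
  rw [gaussWeight, norm_smul_sphere, polyFun_smul hp]
  ring

theorem integral_sphere_eq_zero_of_gaussInt_eq_zero [Nontrivial (Euc n)]
    {p : MvPolynomial (Fin n) ℝ} {d : ℕ} (hp : p.IsHomogeneous d) (h : gaussInt p = 0) :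
    ∫ θ : USphere n, polyFun p θ ∂(sphereMeasure n) = 0 := by
  rw [gaussInt_eq_mul_integral_sphere hp] at h
  rw [sphereMeasure, integral_smul_measure,
    (mul_eq_zero.1 h).resolve_right (integral_gaussian_moment_ne_zero d), smul_zero]

theorem toSphere_univ_ne_zero [Nontrivial (Euc n)] :
    (volume : Measure (Euc n)).toSphere Set.univ ≠ 0 := by
  rw [Ne, Measure.measure_univ_eq_zero]
  exact Measure.toSphere_ne_zero _

instance [Nontrivial (Euc n)] : IsProbabilityMeasure (sphereMeasure n) := by
  constructor
  rw [sphereMeasure, Measure.smul_apply, smul_eq_mul]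
  exact ENNReal.inv_mul_cancel toSphere_univ_ne_zero (measure_ne_top _ _)

instance [Nontrivial (Euc n)] : (sphereMeasure n).IsOpenPosMeasure := by
  refine ⟨fun U hU hne => ?_⟩
  rw [sphereMeasure, Measure.smul_apply, smul_eq_mul]
  exact mul_ne_zero (ENNReal.inv_ne_zero.2 (measure_ne_top _ _)) (hU.measure_ne_zero _ hne)

end polar

/-! ### Spherical harmonics: orthogonality and completeness -/

section harmonics

variable {n : ℕ}

theorem polyRestrict_apply (p : MvPolynomial (Fin n) ℝ) (θ : USphere n) :
    polyRestrict n p θ = polyFun p θ := rfl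

theorem inner_sphereToL2 (f g : C(USphere n, ℝ)) :
    inner ℝ (sphereToL2 n f) (sphereToL2 n g) = ∫ θ, f θ * g θ ∂(sphereMeasure n) := by
  rw [sphereToL2, ContinuousMap.inner_toLp]
  simp [mul_comm]

theorem sphereToL2_injective [Nontrivial (Euc n)] : Function.Injective (sphereToL2 n) :=
  ContinuousMap.toLp_injective _

theorem inner_eq_zero_of_harmonicPoly [Nontrivial (Euc n)] {p q : MvPolynomial (Fin n) ℝ} {m k : ℕ}
    (hp : p ∈ harmonicPoly n m) (hq : q ∈ harmonicPoly n k) (hmk : m ≠ k) :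
    inner ℝ (sphereToL2 n (polyRestrict n p)) (sphereToL2 n (polyRestrict n q)) = 0 := by
  rw [inner_sphereToL2]
  simp only [polyRestrict_apply, ← polyFun_mul]
  exact integral_sphere_eq_zero_of_gaussInt_eq_zero (MvPolynomial.IsHomogeneous.mul hp.1 hq.1)
    (gaussInt_mul_eq_zero hp hq hmk)

theorem orthogonalFamily_sphHarmonic [Nontrivial (Euc n)] :
    OrthogonalFamily ℝ (fun m => sphHarmonic n m) fun m => (sphHarmonic n m).subtypeₗᵢ := by
  rintro m k hmk ⟨_, p, hp, rfl⟩ ⟨_, q, hq, rfl⟩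
  exact inner_eq_zero_of_harmonicPoly hp hq hmk

/-- The polynomial `|x|²`. -/
noncomputable def sqNormPoly (n : ℕ) : MvPolynomial (Fin n) ℝ := ∑ i, MvPolynomial.X i ^ 2

theorem polyFun_sqNormPoly (x : Euc n) : polyFun (sqNormPoly n) x = ‖x‖ ^ 2 := by
  rw [EuclideanSpace.norm_sq_eq, sqNormPoly, polyFun_sum]
  simp [pow_two]

theorem isHomogeneous_sqNormPoly : (sqNormPoly n).IsHomogeneous 2 :=
  MvPolynomial.IsHomogeneous.sum _ _ _ fun i _ => MvPolynomial.isHomogeneous_X_pow i 2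

theorem polyRestrict_sqNormPoly_mul (p : MvPolynomial (Fin n) ℝ) :
    polyRestrict n (sqNormPoly n * p) = polyRestrict n p := by
  ext θ
  simp [polyRestrict_apply, polyFun_sqNormPoly]

theorem polyLaplacian_isHomogeneous {p : MvPolynomial (Fin n) ℝ} {m : ℕ}
    (hp : p.IsHomogeneous (m + 2)) : (polyLaplacian n p).IsHomogeneous m := by
  rw [polyLaplacian_apply]
  exact MvPolynomial.IsHomogeneous.sum _ _ _ fun i _ => hp.pderiv.pderiv

theorem eq_zero_of_polyRestrict_eq_zero [Nontrivial (Euc n)] {p : MvPolynomial (Fin n) ℝ} {m : ℕ}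
    (hp : p.IsHomogeneous m) (h : polyRestrict n p = 0) : p = 0 := by
  have h0 : Set.EqOn (polyFun p) (fun _ => 0) {0}ᶜ := by
    intro x hx
    have h1 : polyFun p (‖x‖ • (‖x‖⁻¹ • x)) = 0 := by
      rw [polyFun_smul hp]
      have h2 := DFunLike.congr_fun h
        (⟨‖x‖⁻¹ • x, by simp [norm_smul, norm_ne_zero_iff.2 hx]⟩ : USphere n)
      rw [polyRestrict_apply] at h2
      rw [h2]; simp
    rwa [smul_inv_smul₀ (norm_ne_zero_iff.2 hx)] at h1
  exact eq_zero_of_polyFun_eq_zero fun x => congrFun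
    (Continuous.ext_on (dense_compl_singleton 0) (continuous_polyFun p) continuous_const h0) x

theorem mem_harmonicPoly_of_le_one {p : MvPolynomial (Fin n) ℝ} {m : ℕ} (hp : p.IsHomogeneous m)
    (hm : m ≤ 1) : p ∈ harmonicPoly n m := by
  refine ⟨hp, LinearMap.mem_ker.2 ?_⟩
  rw [polyLaplacian_apply]
  refine Finset.sum_eq_zero fun i _ => ?_
  have h := hp.pderiv (i := i)
  rw [Nat.sub_eq_zero_of_le hm, ← MvPolynomial.totalDegree_zero_iff_isHomogeneous,
    MvPolynomial.totalDegree_eq_zero_iff_eq_C] at h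
  rw [h, MvPolynomial.pderiv_C]

/-- Restricted to the sphere, a homogeneous polynomial of degree `m` is a sum of spherical harmonics
of degree at most `m`. -/
theorem sphereToL2_polyRestrict_mem [Nontrivial (Euc n)] (m : ℕ) :
    ∀ p : MvPolynomial (Fin n) ℝ, p.IsHomogeneous m →
      sphereToL2 n (polyRestrict n p) ∈ ⨆ k : Fin (m + 1), sphHarmonic n k := by
  induction m using Nat.strong_induction_on with
  | _ m ih =>
    intro p hp
    have hmem : ∀ q ∈ harmonicPoly n m,
        sphereToL2 n (polyRestrict n q) ∈ ⨆ k : Fin (m + 1), sphHarmonic n k := fun q hq =>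
      Submodule.mem_iSup_of_mem (Fin.last m) ⟨q, hq, by simp⟩
    match m, ih, hp, hmem with
    | 0, ih, hp, hmem => exact hmem p (mem_harmonicPoly_of_le_one hp (by norm_num))
    | 1, ih, hp, hmem => exact hmem p (mem_harmonicPoly_of_le_one hp le_rfl)
    | m + 2, ih, hp, hmem =>
      let W := MvPolynomial.homogeneousSubmodule (Fin n) ℝ m
      have : FiniteDimensional ℝ W :=
        Module.Finite.iff_fg.2 (MvPolynomial.homogeneousSubmodule_fg (Fin n) ℝ m)
      -- If T: r ↦ Δ(|x|²r) is onto, then Δp = Δ(|x|²r) for some r, and p = (p - |x|²r) + |x|²r is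
      -- harmonic plus a term that agrees with r on the sphere. In finite dimension injectivity of T
      -- suffices.
      let T : W →ₗ[ℝ] W := LinearMap.codRestrict W
        (polyLaplacian n ∘ₗ LinearMap.mulLeft ℝ (sqNormPoly n) ∘ₗ W.subtype) (by
          rintro ⟨r, hr⟩
          refine polyLaplacian_isHomogeneous ?_
          rw [add_comm]
          exact isHomogeneous_sqNormPoly.mul hr)
      have hT : Function.Injective T := by
        rw [← LinearMap.ker_eq_bot, LinearMap.ker_eq_bot']
        rintro ⟨r, hr⟩ h0
        have h1 : polyLaplacian n (sqNormPoly n * r) = 0 := congrArg Subtype.val h0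
        have h2 : sqNormPoly n * r ∈ harmonicPoly n (m + 2) := by
          refine ⟨?_, h1⟩
          have := isHomogeneous_sqNormPoly.mul hr
          rwa [add_comm] at this
        have h3 := ih m (by omega) r hr
        -- If |x|²r is harmonic of degree m + 2, it is orthogonal to all harmonics of degree at most
        -- m, and by induction to r. On the sphere the two coincide, so r is orthogonal to itself.
        have h4 : inner ℝ (sphereToL2 n (polyRestrict n r)) (sphereToL2 n (polyRestrict n r)) = 0 := by
          have h5 : (⨆ k : Fin (m + 1), sphHarmonic n k) ≤
              (ℝ ∙ sphereToL2 n (polyRestrict n (sqNormPoly n * r)))ᗮ := by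
            refine iSup_le fun k => ?_
            rintro _ ⟨q, hq, rfl⟩
            rw [Submodule.mem_orthogonal_singleton_iff_inner_right]
            exact inner_eq_zero_of_harmonicPoly h2 hq (by omega)
          have h6 := h5 h3
          rwa [Submodule.mem_orthogonal_singleton_iff_inner_right,
            polyRestrict_sqNormPoly_mul] at h6
        have h7 : polyRestrict n r = 0 :=
          sphereToL2_injective (by rw [inner_self_eq_zero.1 h4, map_zero])
        exact Subtype.ext (eq_zero_of_polyRestrict_eq_zero hr h7)
      obtain ⟨⟨r, hr⟩, hrT⟩ := LinearMap.injective_iff_surjective.1 hT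
        ⟨polyLaplacian n p, polyLaplacian_isHomogeneous hp⟩
      have h1 : polyLaplacian n (sqNormPoly n * r) = polyLaplacian n p := congrArg Subtype.val hrT
      have h2 : (sqNormPoly n * r).IsHomogeneous (m + 2) := by
        have := isHomogeneous_sqNormPoly.mul hr
        rwa [add_comm] at this
      have h3 : p - sqNormPoly n * r ∈ harmonicPoly n (m + 2) :=
        ⟨Submodule.sub_mem _ hp h2, LinearMap.mem_ker.2 (by rw [map_sub, h1, sub_self])⟩
      have h4 := hmem _ h3
      have h5 := ih m (by omega) r hr
      have h6 : (⨆ k : Fin (m + 1), sphHarmonic n k) ≤ ⨆ k : Fin (m + 2 + 1), sphHarmonic n k :=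
        iSup_le fun k => le_iSup_of_le (⟨k, by omega⟩ : Fin (m + 2 + 1)) le_rfl
      have h7 := Submodule.add_mem _ h4 (h6 h5)
      rw [map_sub, map_sub, polyRestrict_sqNormPoly_mul, sub_add_cancel] at h7
      exact h7

/-- Polynomial functions are dense among continuous functions on the sphere. -/
theorem dense_polyRestrict : DenseRange (polyRestrict n) := by
  let A : MvPolynomial (Fin n) ℝ →ₐ[ℝ] C(USphere n, ℝ) := AlgHom.ofLinearMap (polyRestrict n)
    (by ext θ; simp [polyRestrict_apply]) (fun p q => by ext θ; simp [polyRestrict_apply])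
  have h := ContinuousMap.subalgebra_topologicalClosure_eq_top_of_separatesPoints A.range (by
    intro θ φ hne
    have : ∃ i, (θ : Euc n) i ≠ (φ : Euc n) i := by
      by_contra! h
      exact hne (Subtype.ext (PiLp.ext h))
    obtain ⟨i, hi⟩ := this
    refine ⟨A (MvPolynomial.X i), ⟨A (MvPolynomial.X i), ⟨_, rfl⟩, rfl⟩, ?_⟩
    simpa [A, polyRestrict_apply] using hi)
  intro f
  have : f ∈ A.range.topologicalClosure := by rw [h]; trivial
  exact this

theorem dense_iSup_sphHarmonic [Nontrivial (Euc n)] :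
    Dense ((⨆ m, sphHarmonic n m : Submodule ℝ (SphereL2 n)) : Set (SphereL2 n)) := by
  have h1 : DenseRange (sphereToL2 n ∘ polyRestrict n) :=
    (ContinuousMap.toLp_denseRange ℝ _ ℝ (by norm_num)).comp dense_polyRestrict
      (sphereToL2 n).continuous
  refine h1.mono ?_
  rintro _ ⟨p, rfl⟩
  simp only [Function.comp, SetLike.mem_coe]
  rw [← MvPolynomial.sum_homogeneousComponent p, map_sum, map_sum]
  refine Submodule.sum_mem _ fun m _ => ?_
  have h2 := sphereToL2_polyRestrict_mem m _ (MvPolynomial.homogeneousComponent_isHomogeneous m p)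
  have h3 : (⨆ k : Fin (m + 1), sphHarmonic n k) ≤ ⨆ k, sphHarmonic n k :=
    iSup_le fun k => le_iSup (sphHarmonic n) k
  exact h3 h2

end harmonics

/-! ### Strong contractions -/

section contraction

variable {n : ℕ}

theorem norm_sum_smul_le_of_orthogonalFamily {ι F : Type*} [NormedAddCommGroup F]
    [InnerProductSpace ℝ F] {V : ι → Submodule ℝ F}
    (hV : OrthogonalFamily ℝ (fun i => V i) fun i => (V i).subtypeₗᵢ) (s : Finset ι) (x : ι → F)
    (hx : ∀ i, x i ∈ V i) {ν : ι → ℝ} {b : ℝ} (hb : 0 ≤ b) (hν : ∀ i, |ν i| ≤ b) :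
    ‖∑ i ∈ s, ν i • x i‖ ≤ b * ‖∑ i ∈ s, x i‖ := by
  have h1 : ‖∑ i ∈ s, x i‖ ^ 2 = ∑ i ∈ s, ‖x i‖ ^ 2 := by
    simpa using hV.norm_sum (fun i => ⟨x i, hx i⟩) s
  have h2 : ‖∑ i ∈ s, ν i • x i‖ ^ 2 = ∑ i ∈ s, ‖ν i • x i‖ ^ 2 := by
    simpa using hV.norm_sum (fun i => ⟨ν i • x i, (V i).smul_mem _ (hx i)⟩) s
  refine le_of_sq_le_sq ?_ (by positivity)
  rw [mul_pow, h1, h2, Finset.mul_sum]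
  refine Finset.sum_le_sum fun i _ => ?_
  rw [norm_smul, mul_pow]
  gcongr
  exact hν i

theorem exists_lt_one_forall_abs_le {μ : ℕ → ℝ} (h : ∀ m, |μ m| < 1)
    (h0 : Tendsto μ atTop (𝓝 0)) : ∃ q, 0 ≤ q ∧ q < 1 ∧ ∀ m, |μ m| ≤ q := by
  obtain ⟨N, hN⟩ := eventually_atTop.1 (h0.abs.eventually_le_const (u := 1 / 2) (by simp))
  have hne : ((Finset.range (N + 1)).image fun m => |μ m|).Nonempty := by simp
  refine ⟨max (1 / 2) (((Finset.range (N + 1)).image fun m => |μ m|).max' hne), by positivity,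
    max_lt (by norm_num) ?_, fun m => ?_⟩
  · rw [Finset.max'_lt_iff]
    simp only [Finset.mem_image]
    rintro _ ⟨m, _, rfl⟩
    exact h m
  · rcases le_or_gt N m with hm | hm
    · exact (hN m hm).trans (le_max_left _ _)
    · refine le_max_of_le_right (Finset.le_max' _ _ ?_)
      exact Finset.mem_image_of_mem _ (Finset.mem_range.2 (by omega))

theorem starProjection_sphHarmonic_of_mem [Nontrivial (Euc n)] {m k : ℕ} {f : SphereL2 n}
    (hf : f ∈ sphHarmonic n k) :
    (sphHarmonic n m).starProjection f = if m = k then f else 0 := by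
  split_ifs with h
  · subst h
    exact Submodule.starProjection_eq_self_iff.2 hf
  · rw [Submodule.starProjection_apply_eq_zero_iff]
    intro g hg
    exact orthogonalFamily_sphHarmonic h ⟨g, hg⟩ ⟨f, hf⟩

/-- A strong contraction is, up to a small error, a contraction into finitely many spaces of
spherical harmonics. -/
theorem IsStrongContraction.exists_approx [Nontrivial (Euc n)] {M : SphereL2 n →L[ℝ] SphereL2 n}
    (hM : IsStrongContraction M) :
    ∃ q : ℝ, 0 ≤ q ∧ q < 1 ∧ ∀ η : ℝ, 0 < η → ∃ N : ℕ, ∀ f : SphereL2 n,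
      ∃ g ∈ ⨆ m : Fin N, sphHarmonic n m, ‖M f - g‖ ≤ η * ‖f‖ ∧ ‖g‖ ≤ q * ‖f‖ := by
  obtain ⟨μ, hμ, hμ1, hμ0⟩ := hM
  obtain ⟨q, hq0, hq1, hq⟩ := exists_lt_one_forall_abs_le hμ1 hμ0
  refine ⟨q, hq0, hq1, fun η hη => ?_⟩
  obtain ⟨N, hN⟩ := eventually_atTop.1 (hμ0.abs.eventually_le_const (u := η) (by simpa))
  let P : SphereL2 n →L[ℝ] SphereL2 n :=
    ∑ m ∈ Finset.range N, (sphHarmonic n m).starProjection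
  have hP : ∀ k, ∀ f ∈ sphHarmonic n k, P f = if k < N then f else 0 := by
    intro k f hf
    simp only [P, sum_apply, starProjection_sphHarmonic_of_mem hf]
    simp
  -- Both bounds are closed conditions, so they need checking only on finite sums of harmonics.
  -- There M - MP and MP act by multipliers bounded by η and q respectively.
  have key : ∀ f : SphereL2 n, ‖M f - M (P f)‖ ≤ η * ‖f‖ ∧ ‖M (P f)‖ ≤ q * ‖f‖ := by
    intro f
    refine (dense_iSup_sphHarmonic (n := n)).induction
      (P := fun f => ‖M f - M (P f)‖ ≤ η * ‖f‖ ∧ ‖M (P f)‖ ≤ q * ‖f‖) ?_ ?_ f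
    · intro f hf
      obtain ⟨x, hx, rfl⟩ := (Submodule.mem_iSup_iff_exists_finsupp _ _).1 hf
      have h1 : M (P (x.sum fun _ y => y)) =
          ∑ i ∈ x.support, (if i < N then μ i else 0) • x i := by
        simp only [Finsupp.sum, map_sum]
        refine Finset.sum_congr rfl fun i _ => ?_
        rw [hP i _ (hx i)]
        split_ifs
        · rw [hμ i _ (hx i)]
        · simp
      have h2 : M (x.sum fun _ y => y) - M (P (x.sum fun _ y => y)) =
          ∑ i ∈ x.support, (if i < N then 0 else μ i) • x i := by
        rw [h1]
        simp only [Finsupp.sum, map_sum, ← Finset.sum_sub_distrib]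
        refine Finset.sum_congr rfl fun i _ => ?_
        rw [hμ i _ (hx i)]
        split_ifs <;> simp
      rw [h2, h1]
      refine ⟨norm_sum_smul_le_of_orthogonalFamily orthogonalFamily_sphHarmonic _ _ hx hη.le ?_,
        norm_sum_smul_le_of_orthogonalFamily orthogonalFamily_sphHarmonic _ _ hx hq0 ?_⟩
      · intro i
        split_ifs with h
        · simpa using hη.le
        · exact hN i (by omega)
      · intro i
        split_ifs with h
        · exact hq i
        · simpa using hq0
    · have h1 : IsClosed {f : SphereL2 n | ‖M f - M (P f)‖ ≤ η * ‖f‖} :=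
        isClosed_le (by fun_prop) (by fun_prop)
      have h2 : IsClosed {f : SphereL2 n | ‖M (P f)‖ ≤ q * ‖f‖} :=
        isClosed_le (by fun_prop) (by fun_prop)
      exact h1.inter h2
  refine ⟨N, fun f => ⟨M (P f), ?_, key f⟩⟩
  simp only [P, sum_apply, map_sum]
  refine Submodule.sum_mem _ fun m hm => ?_
  have h1 := Submodule.starProjection_apply_mem (sphHarmonic n m) f
  rw [hμ m _ h1]
  exact Submodule.smul_mem _ _
    (Submodule.mem_iSup_of_mem (⟨m, Finset.mem_range.1 hm⟩ : Fin N) h1)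

end contraction

/-! ### Lipschitz bounds for finite sums of spherical harmonics -/

section lipschitz

variable {n : ℕ}

theorem exists_lipschitz_polyRestrict (p : MvPolynomial (Fin n) ℝ) :
    ∃ Λ : ℝ, 0 ≤ Λ ∧ (∀ θ, |polyRestrict n p θ| ≤ Λ) ∧
      ∀ θ φ : USphere n, |polyRestrict n p θ - polyRestrict n p φ| ≤ Λ * dist θ φ := by
  simp only [polyRestrict_apply]
  induction p using MvPolynomial.induction_on with
  | C a => exact ⟨|a|, abs_nonneg _, fun θ => by simp, fun θ φ => by simp; positivity⟩
  | add p q hp hq =>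
    obtain ⟨A, hA, hA1, hA2⟩ := hp
    obtain ⟨B, hB, hB1, hB2⟩ := hq
    refine ⟨A + B, by positivity, fun θ => ?_, fun θ φ => ?_⟩
    · rw [polyFun_add]
      exact (abs_add_le _ _).trans (add_le_add (hA1 θ) (hB1 θ))
    · rw [polyFun_add, polyFun_add, add_sub_add_comm, add_mul]
      exact (abs_add_le _ _).trans (add_le_add (hA2 θ φ) (hB2 θ φ))
  | mul_X p i hp =>
    obtain ⟨A, hA, hA1, hA2⟩ := hp
    have h1 : ∀ θ : USphere n, |(θ : Euc n) i| ≤ 1 := by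
      intro θ
      have := PiLp.norm_apply_le (θ : Euc n) i
      rwa [norm_eq_of_mem_sphere] at this
    refine ⟨2 * A, by positivity, fun θ => ?_, fun θ φ => ?_⟩
    · rw [polyFun_mul, polyFun_X, abs_mul]
      nlinarith [hA1 θ, h1 θ, abs_nonneg (polyFun p θ), abs_nonneg ((θ : Euc n) i)]
    · rw [polyFun_mul, polyFun_X, polyFun_mul, polyFun_X]
      have h2 : |(θ : Euc n) i - (φ : Euc n) i| ≤ dist θ φ := by
        have := PiLp.norm_apply_le ((θ : Euc n) - (φ : Euc n)) i
        rwa [← dist_eq_norm] at this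
      have h3 : polyFun p (θ : Euc n) * (θ : Euc n) i - polyFun p (φ : Euc n) * (φ : Euc n) i =
          (polyFun p θ - polyFun p φ) * (θ : Euc n) i +
            polyFun p φ * ((θ : Euc n) i - (φ : Euc n) i) := by ring
      rw [h3]
      refine (abs_add_le _ _).trans ?_
      rw [abs_mul, abs_mul]
      have h4 := mul_le_mul (hA2 θ φ) (h1 θ) (abs_nonneg _) (by positivity)
      have h5 := mul_le_mul (hA1 φ) h2 (abs_nonneg _) hA
      linarith

/-- Expand in an orthonormal basis of polynomial functions: the coefficients are at most ‖g‖, and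
the Lipschitz constants of the basis add up to a Λ independent of g. -/
theorem exists_lipschitz_of_finiteDimensional (V : Submodule ℝ (SphereL2 n))
    [FiniteDimensional ℝ V]
    (hV : V ≤ LinearMap.range ((sphereToL2 n).toLinearMap ∘ₗ polyRestrict n)) :
    ∃ Λ : ℝ, 0 ≤ Λ ∧ ∀ g ∈ V, ∃ u : C(USphere n, ℝ), sphereToL2 n u = g ∧
      (∀ θ, |u θ| ≤ Λ * ‖g‖) ∧ ∀ θ φ, |u θ - u φ| ≤ Λ * ‖g‖ * dist θ φ := by
  let b := stdOrthonormalBasis ℝ V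
  have h1 : ∀ i, ∃ p, sphereToL2 n (polyRestrict n p) = (b i : SphereL2 n) := fun i => hV (b i).2
  choose p hp using h1
  choose A hA hA1 hA2 using fun i => exists_lipschitz_polyRestrict (p i)
  refine ⟨∑ i, A i, Finset.sum_nonneg fun i _ => hA i, fun g hg => ?_⟩
  have hc : ∀ i, |inner ℝ (b i) (⟨g, hg⟩ : V)| ≤ ‖g‖ := by
    intro i
    refine (abs_real_inner_le_norm _ _).trans ?_
    rw [b.orthonormal.1 i, one_mul]
    rfl
  refine ⟨∑ i, inner ℝ (b i) (⟨g, hg⟩ : V) • polyRestrict n (p i), ?_, fun θ => ?_, fun θ φ => ?_⟩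
  · rw [map_sum]
    simp only [map_smul, hp]
    have h2 := congrArg Subtype.val (b.sum_repr' ⟨g, hg⟩)
    simpa using h2
  · rw [ContinuousMap.sum_apply, Finset.sum_mul]
    refine (Finset.abs_sum_le_sum_abs _ _).trans (Finset.sum_le_sum fun i _ => ?_)
    rw [ContinuousMap.smul_apply, smul_eq_mul, abs_mul, mul_comm]
    exact mul_le_mul (hA1 i θ) (hc i) (abs_nonneg _) (hA i)
  · rw [ContinuousMap.sum_apply, ContinuousMap.sum_apply, ← Finset.sum_sub_distrib, Finset.sum_mul,
      Finset.sum_mul]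
    refine (Finset.abs_sum_le_sum_abs _ _).trans (Finset.sum_le_sum fun i _ => ?_)
    rw [ContinuousMap.smul_apply, ContinuousMap.smul_apply, smul_eq_mul, smul_eq_mul, ← mul_sub,
      abs_mul]
    calc _ ≤ ‖g‖ * (A i * dist θ φ) :=
          mul_le_mul (hc i) (hA2 i θ φ) (abs_nonneg _) (norm_nonneg _)
      _ = _ := by ring

theorem iSup_sphHarmonic_le_range (N : ℕ) : ⨆ m : Fin N, sphHarmonic n m ≤
    LinearMap.range ((sphereToL2 n).toLinearMap ∘ₗ polyRestrict n) :=
  iSup_le fun _ => LinearMap.map_le_range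

end lipschitz

/-! ### The constant term -/

section constant

variable {n : ℕ}

theorem norm_sphereToL2_sq (f : C(USphere n, ℝ)) :
    ‖sphereToL2 n f‖ ^ 2 = ∫ θ, f θ ^ 2 ∂(sphereMeasure n) := by
  rw [← real_inner_self_eq_norm_sq, inner_sphereToL2]
  simp [pow_two]

theorem norm_sphereToL2_mono {f g : C(USphere n, ℝ)} (h : ∀ θ, |f θ| ≤ g θ) :
    ‖sphereToL2 n f‖ ≤ ‖sphereToL2 n g‖ := by
  refine le_of_sq_le_sq ?_ (norm_nonneg _)
  rw [norm_sphereToL2_sq, norm_sphereToL2_sq]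
  refine integral_mono ((f.continuous.pow 2).integrable_of_hasCompactSupport
    (HasCompactSupport.of_compactSpace _)) ((g.continuous.pow 2).integrable_of_hasCompactSupport
    (HasCompactSupport.of_compactSpace _)) fun θ => ?_
  exact sq_le_sq' (by linarith [abs_le.1 (h θ)]) (by linarith [abs_le.1 (h θ)])

theorem norm_sphereToL2_one [Nontrivial (Euc n)] :
    ‖sphereToL2 n (1 : C(USphere n, ℝ))‖ = 1 := by
  have h := norm_sphereToL2_sq (1 : C(USphere n, ℝ))
  simp only [ContinuousMap.one_apply, one_pow, integral_const, probReal_univ, smul_eq_mul,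
    mul_one] at h
  nlinarith [norm_nonneg (sphereToL2 n (1 : C(USphere n, ℝ)))]

theorem sphHarmonic_zero : sphHarmonic n 0 = ℝ ∙ sphereToL2 n (1 : C(USphere n, ℝ)) := by
  refine le_antisymm ?_ ?_
  · rintro _ ⟨p, hp, rfl⟩
    have h := hp.1
    rw [SetLike.mem_coe, MvPolynomial.mem_homogeneousSubmodule,
      ← MvPolynomial.totalDegree_zero_iff_isHomogeneous,
      MvPolynomial.totalDegree_eq_zero_iff_eq_C] at h
    rw [Submodule.mem_span_singleton]
    refine ⟨MvPolynomial.coeff 0 p, ?_⟩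
    rw [← map_smul]
    change _ = sphereToL2 n (polyRestrict n p)
    congr 1
    ext θ
    rw [h, polyRestrict_apply]
    simp
  · rw [Submodule.span_singleton_le_iff_mem]
    refine ⟨1, mem_harmonicPoly_of_le_one (MvPolynomial.isHomogeneous_one _ _) (by norm_num), ?_⟩
    change sphereToL2 n (polyRestrict n 1) = _
    congr 1
    ext θ
    simp [polyRestrict_apply]

theorem harmonicTerm_zero_sphereToL2 [Nontrivial (Euc n)] (f : C(USphere n, ℝ)) :
    harmonicTerm n 0 (sphereToL2 n f) =
      sphereToL2 n (ContinuousMap.const _ (∫ θ, f θ ∂(sphereMeasure n))) := by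
  have h : ∀ g, harmonicTerm n 0 g =
      (ℝ ∙ sphereToL2 n (1 : C(USphere n, ℝ))).starProjection g := by
    intro g
    simp only [harmonicTerm, sphHarmonic_zero]
  rw [h, Submodule.starProjection_unit_singleton _ norm_sphereToL2_one, inner_sphereToL2, ← map_smul]
  congr 1
  ext θ
  simp

/-- The mean is the nearest constant in L². This allows the mean of `ρ_K` to be replaced by 1 or by
the mean of `h_K`. -/
theorem norm_sub_harmonicTerm_zero_le [Nontrivial (Euc n)] (f : SphereL2 n) (a : ℝ) :
    ‖f - harmonicTerm n 0 f‖ ≤ ‖f - sphereToL2 n (ContinuousMap.const _ a)‖ := by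
  rw [harmonicTerm, Submodule.starProjection_minimal]
  refine ciInf_le ⟨0, by rintro _ ⟨x, rfl⟩; positivity⟩
    (⟨sphereToL2 n (ContinuousMap.const _ a), ?_⟩ : sphHarmonic n 0)
  rw [sphHarmonic_zero, Submodule.mem_span_singleton]
  refine ⟨a, ?_⟩
  rw [← map_smul]
  congr 1
  ext θ
  simp

end constant

/-! ### Homogeneous extensions of degree zero and a density estimate -/

section density

variable {n : ℕ}

open Classical in
/-- The extension of a function on the sphere that is homogeneous of degree `0` away from the
origin. -/
noncomputable def sphExt (f : USphere n → ℝ) (x : Euc n) : ℝ :=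
  if h : x = 0 then 0 else f ⟨‖x‖⁻¹ • x, by simp [norm_smul, h]⟩

theorem sphExt_of_ne_zero (f : USphere n → ℝ) {x : Euc n} (h : x ≠ 0) :
    sphExt f x = f ⟨‖x‖⁻¹ • x, by simp [norm_smul, h]⟩ := dif_neg h

theorem sphExt_smul (f : USphere n → ℝ) {t : ℝ} (ht : 0 < t) (x : Euc n) :
    sphExt f (t • x) = sphExt f x := by
  rcases eq_or_ne x 0 with rfl | hx
  · simp
  · rw [sphExt_of_ne_zero f hx, sphExt_of_ne_zero f (smul_ne_zero ht.ne' hx)]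
    congr 2
    rw [norm_smul, Real.norm_of_nonneg ht.le, smul_smul]
    congr 1
    field_simp

theorem sphExt_coe (f : USphere n → ℝ) (θ : USphere n) : sphExt f θ = f θ := by
  rw [sphExt_of_ne_zero f (ne_zero_of_mem_unit_sphere θ)]
  congr 1
  ext1
  simp

theorem measurable_sphExt {f : USphere n → ℝ} (hf : Continuous f) : Measurable (sphExt f) := by
  refine measurable_of_measurable_on_compl_singleton 0 ?_
  have h : Set.domRestrict {x : Euc n | x ≠ 0} (sphExt f) =
      fun x : {x : Euc n | x ≠ 0} => f ⟨‖(x : Euc n)‖⁻¹ • (x : Euc n), by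
        simp [norm_smul, norm_ne_zero_iff.2 x.2]⟩ := by
    ext x
    exact sphExt_of_ne_zero f x.2
  rw [h]
  refine Continuous.measurable (hf.comp ?_)
  refine Continuous.subtype_mk ?_ _
  exact (Continuous.inv₀ (continuous_norm.comp continuous_subtype_val)
    fun x => norm_ne_zero_iff.2 x.2).smul continuous_subtype_val

/-- This passes between the sphere and solid annuli, where translations and dilations of Lebesgue
measure are available. -/
theorem setLIntegral_annulus_sphExt [Nontrivial (Euc n)] {f : USphere n → ℝ} (hf : Continuous f)
    {F : ℝ → ENNReal} (hF : Measurable F) (a b : ℝ) :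
    ∫⁻ x in {x : Euc n | a < ‖x‖ ∧ ‖x‖ < b}, F (sphExt f x) =
      (∫⁻ θ, F (f θ) ∂(volume : Measure (Euc n)).toSphere) *
        Measure.volumeIoiPow (n - 1) {r | a < (r : ℝ) ∧ (r : ℝ) < b} := by
  have hm : MeasurableSet {x : Euc n | a < ‖x‖ ∧ ‖x‖ < b} :=
    (measurableSet_lt measurable_const measurable_norm).inter
      (measurableSet_lt measurable_norm measurable_const)
  have hm' : MeasurableSet {r : Set.Ioi (0 : ℝ) | a < (r : ℝ) ∧ (r : ℝ) < b} :=
    (measurableSet_lt measurable_const measurable_subtype_coe).inter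
      (measurableSet_lt measurable_subtype_coe measurable_const)
  rw [← lintegral_indicator hm, lintegral_eq_lintegral_polar, ← lintegral_indicator_one hm',
    ← lintegral_prod_mul (f := fun θ => F (f θ)) (hF.comp hf.measurable).aemeasurable
      (measurable_one.indicator hm').aemeasurable]
  refine lintegral_congr fun z => ?_
  have h1 : F (sphExt f ((z.2 : ℝ) • (z.1 : Euc n))) = F (f z.1) := by
    rw [sphExt_smul f z.2.2, sphExt_coe]
  simp only [Set.indicator_apply, Set.mem_ofPred_eq, norm_smul_sphere, h1, Pi.one_apply, mul_ite,
    mul_one, mul_zero]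

/-- By the polar formula for a constant integrand, a zero value would make a nonempty open annulus
null. -/
theorem volumeIoiPow_annulus_ne_zero [Nontrivial (Euc n)] {a b : ℝ} (ha : 0 < a) (hab : a < b) :
    Measure.volumeIoiPow (n - 1) {r | a < (r : ℝ) ∧ (r : ℝ) < b} ≠ 0 := by
  intro h0
  have h := setLIntegral_annulus_sphExt (n := n) (f := fun _ => 0) continuous_const
    (F := fun _ => 1) measurable_const a b
  rw [h0, mul_zero, setLIntegral_one] at h
  have ho : IsOpen {x : Euc n | a < ‖x‖ ∧ ‖x‖ < b} :=
    (isOpen_lt continuous_const continuous_norm).inter (isOpen_lt continuous_norm continuous_const)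
  refine ho.measure_ne_zero volume ?_ h
  obtain ⟨x, hx⟩ := exists_norm_eq (Euc n) (c := (a + b) / 2) (by linarith)
  exact ⟨x, by rw [hx]; linarith, by rw [hx]; linarith⟩

theorem volumeIoiPow_annulus_ne_top (k : ℕ) (a b : ℝ) :
    Measure.volumeIoiPow k {r | a < (r : ℝ) ∧ (r : ℝ) < b} ≠ ⊤ := by
  rcases le_or_gt b 0 with hb | hb
  · have : {r : Set.Ioi (0 : ℝ) | a < (r : ℝ) ∧ (r : ℝ) < b} = ∅ := by
      ext r
      have := r.2.out
      simp only [Set.mem_ofPred_eq, Set.mem_empty_iff_false, iff_false]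
      intro h; linarith [h.2]
    rw [this]; simp
  · refine ne_top_of_le_ne_top ?_ (measure_mono (t := Set.Iio (⟨b, hb⟩ : Set.Ioi (0 : ℝ)))
      fun r hr => hr.2)
    rw [Measure.volumeIoiPow_apply_Iio]
    exact ENNReal.ofReal_ne_top

theorem lintegral_measure_inter_ball {G : Set (Euc n)} (hG : MeasurableSet G) (ρ : ℝ) :
    ∫⁻ x : Euc n, volume (G ∩ Metric.ball x ρ) = volume G * volume (Metric.ball (0 : Euc n) ρ) := by
  let s : Set (Euc n × Euc n) := {z | z.2 ∈ G ∧ dist z.2 z.1 < ρ}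
  have hs : MeasurableSet s :=
    (measurable_snd hG).inter (measurableSet_lt (measurable_snd.dist measurable_fst) measurable_const)
  have h1 := Measure.prod_apply (μ := (volume : Measure (Euc n))) (ν := volume) hs
  have h2 := Measure.prod_apply_symm (μ := (volume : Measure (Euc n))) (ν := volume) hs
  have h3 : ∀ x, Prod.mk x ⁻¹' s = G ∩ Metric.ball x ρ := fun x => rfl
  have h4 : ∀ y, volume ((fun x => (x, y)) ⁻¹' s) =
      G.indicator (fun _ => volume (Metric.ball (0 : Euc n) ρ)) y := by
    intro y
    by_cases hy : y ∈ G
    · rw [Set.indicator_of_mem hy, ← Measure.addHaar_ball_center volume y ρ]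
      congr 1
      ext x
      simp [s, hy, dist_comm]
    · rw [Set.indicator_of_notMem hy]
      simp [s, hy]
  simp only [h3] at h1
  simp only [h4] at h2
  rw [← h1, h2, lintegral_indicator hG, setLIntegral_const, mul_comm]

theorem measurable_measure_inter_ball {G : Set (Euc n)} (hG : MeasurableSet G) (ρ : ℝ) :
    Measurable fun x : Euc n => volume (G ∩ Metric.ball x ρ) := by
  let s : Set (Euc n × Euc n) := {z | z.2 ∈ G ∧ dist z.2 z.1 < ρ}
  have hs : MeasurableSet s :=
    (measurable_snd hG).inter (measurableSet_lt (measurable_snd.dist measurable_fst) measurable_const)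
  exact measurable_measure_prodMk_left hs

/-- Markov's inequality applied to the Fubini identity `lintegral_measure_inter_ball`; it replaces a
maximal function, since each scale is treated on its own. -/
theorem mul_measure_le_of_density {G : Set (Euc n)} (hG : MeasurableSet G) (ρ : ℝ) (c : ENNReal) :
    c * volume {x | c ≤ volume (G ∩ Metric.ball x ρ)} ≤
      volume G * volume (Metric.ball (0 : Euc n) ρ) := by
  rw [← lintegral_measure_inter_ball hG]
  exact mul_meas_ge_le_lintegral (measurable_measure_inter_ball hG ρ) c

/-- The sum is a geometric tail, comparable to its first term, which is at most t². It reassembles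
the dyadic level sets of |e| into e². -/
theorem tsum_ite_pow_le (t : ℝ) :
    ∑' k : ℕ, (if (1 / 4 : ℝ) ^ k ≤ t then ENNReal.ofReal ((1 / 16 : ℝ) ^ k) else 0) ≤
      ENNReal.ofReal (2 * t ^ 2) := by
  by_cases h : ∃ k : ℕ, (1 / 4 : ℝ) ^ k ≤ t
  · have hmin : ∀ P : ℕ → Prop, (∃ k, P k) → ∃ N, P N ∧ ∀ k < N, ¬ P k := fun P h => by
      classical exact ⟨Nat.find h, Nat.find_spec h, fun k hk => Nat.find_min h hk⟩
    obtain ⟨N, hN, hlt⟩ := hmin _ h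
    let f : ℕ → ENNReal := fun k =>
      if (1 / 4 : ℝ) ^ k ≤ t then ENNReal.ofReal ((1 / 16 : ℝ) ^ k) else 0
    have hf : ∑' k, f k = ∑' k, f (k + N) := by
      rw [← Summable.sum_add_tsum_nat_add' (f := f) (k := N) ENNReal.summable, Finset.sum_eq_zero,
        zero_add]
      exact fun k hk => if_neg (hlt k (Finset.mem_range.1 hk))
    refine hf.trans_le ?_
    · have hs : Summable fun k : ℕ => (1 / 16 : ℝ) ^ (k + N) :=
        (summable_nat_add_iff N).2 (summable_geometric_of_lt_one (by norm_num) (by norm_num))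
      calc _ ≤ ∑' k : ℕ, ENNReal.ofReal ((1 / 16 : ℝ) ^ (k + N)) :=
            ENNReal.tsum_le_tsum fun k => by simp only [f]; split_ifs <;> simp
        _ = ENNReal.ofReal (∑' k : ℕ, (1 / 16 : ℝ) ^ (k + N)) :=
            (ENNReal.ofReal_tsum_of_nonneg (fun k => by positivity) hs).symm
        _ ≤ ENNReal.ofReal (2 * t ^ 2) := by
            refine ENNReal.ofReal_le_ofReal ?_
            simp only [pow_add]
            rw [tsum_mul_right, tsum_geometric_of_lt_one (by norm_num) (by norm_num)]
            have h1 : (1 / 16 : ℝ) ^ N = ((1 / 4) ^ N) ^ 2 := by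
              rw [← pow_mul, mul_comm, pow_mul]; norm_num
            have h2 : (0 : ℝ) ≤ (1 / 4) ^ N := by positivity
            rw [h1]
            nlinarith [sq_nonneg ((1 / 4 : ℝ) ^ N), mul_le_mul hN hN h2 (h2.trans hN)]
  · push Not at h
    have h0 : ∀ k : ℕ, (if (1 / 4 : ℝ) ^ k ≤ t then ENNReal.ofReal ((1 / 16 : ℝ) ^ k) else 0) = 0 :=
      fun k => if_neg (not_le.2 (h k))
    simp only [h0, tsum_zero, zero_le]

/-- The points of the annulus `a < |y| < b` where the extension of `e` is not small. -/
def largeSet (e : USphere n → ℝ) (a b s : ℝ) : Set (Euc n) :=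
  {y | (a < ‖y‖ ∧ ‖y‖ < b) ∧ s ≤ |sphExt e y|}

theorem measurableSet_largeSet {e : USphere n → ℝ} (he : Continuous e) (a b s : ℝ) :
    MeasurableSet (largeSet e a b s) :=
  ((measurableSet_lt measurable_const measurable_norm).inter
    (measurableSet_lt measurable_norm measurable_const)).inter
      (measurableSet_le measurable_const (measurable_sphExt he).abs)

open scoped Pointwise in
-- Dilation by t moves the density condition from a point of the sphere to the point of norm t on
-- the same ray. It increases volume, and t < 2 explains the outer radius 4 and the doubled ball.
theorem volume_largeSet_inter_ball_le (e : USphere n → ℝ) (s R : ℝ) (θ : USphere n) {t : ℝ}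
    (ht : 1 < t) (ht' : t < 2) (hR : 0 ≤ R) :
    volume (largeSet e (1 / 2) 2 s ∩ Metric.ball (θ : Euc n) R) ≤
      volume (largeSet e (1 / 2) 4 s ∩ Metric.ball (t • (θ : Euc n)) (2 * R)) := by
  have ht0 : 0 < t := by linarith
  have h1 : t • (largeSet e (1 / 2) 2 s ∩ Metric.ball (θ : Euc n) R) ⊆
      largeSet e (1 / 2) 4 s ∩ Metric.ball (t • (θ : Euc n)) (2 * R) := by
    rintro _ ⟨y, ⟨⟨⟨hy1, hy2⟩, hy3⟩, hy4⟩, rfl⟩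
    have hn : ‖t • y‖ = t * ‖y‖ := by rw [norm_smul, Real.norm_of_nonneg ht0.le]
    simp only
    refine ⟨⟨⟨?_, ?_⟩, ?_⟩, ?_⟩
    · rw [hn]; nlinarith
    · rw [hn]; nlinarith
    · rwa [sphExt_smul e ht0]
    · rw [Metric.mem_ball, dist_smul₀, Real.norm_of_nonneg ht0.le]
      have := Metric.mem_ball.1 hy4
      nlinarith [dist_nonneg (x := y) (y := (θ : Euc n))]
  refine le_trans ?_ (measure_mono h1)
  rw [Measure.addHaar_smul]
  refine le_mul_of_one_le_left zero_le ?_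
  rw [abs_of_nonneg (by positivity)]
  exact ENNReal.one_le_ofReal.2 (one_le_pow₀ ht.le)

theorem setLIntegral_annulus_le_of_density [Nontrivial (Euc n)] {R c : ℝ} (hR : 0 ≤ R) (hc : 0 < c) (B : ℝ)
    {b : ℝ} (hb : 0 < b) {e D : USphere n → ℝ} (he : Continuous e)
    (h : ∀ θ, D θ ≠ 0 → ∃ k : ℕ, |D θ| ≤ B * (1 / 4) ^ k ∧
      ENNReal.ofReal (c * ((1 / 2) ^ k) ^ n) ≤ volume (largeSet e (1 / 2) 2 ((1 / 4) ^ k / b) ∩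
        Metric.ball (θ : Euc n) (R * (1 / 2) ^ k))) :
    ∫⁻ x in {x : Euc n | 1 < ‖x‖ ∧ ‖x‖ < 2}, ENNReal.ofReal (sphExt D x ^ 2) ≤
      ENNReal.ofReal (B ^ 2) * (ENNReal.ofReal ((2 * R) ^ n / c) *
        volume (Metric.ball (0 : Euc n) 1)) *
      ∫⁻ x in {x : Euc n | 1 / 2 < ‖x‖ ∧ ‖x‖ < 4},
        ENNReal.ofReal (2 * (b * |sphExt e x|) ^ 2) := by
  let G : ℕ → Set (Euc n) := fun k => largeSet e (1 / 2) 4 ((1 / 4) ^ k / b)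
  -- `U k` collects the points near which `G k` has the required density at scale 2⁻ᵏ, so `U k` is
  -- at most w times as large as `G k`. The sets `U k` cover the points where D is nonzero, with D²
  -- ≤ B²·16⁻ᵏ at a suitable k.
  let U : ℕ → Set (Euc n) := fun k => {x | ENNReal.ofReal (c * ((1 / 2) ^ k) ^ n) ≤
    volume (G k ∩ Metric.ball x (2 * (R * (1 / 2) ^ k)))}
  have hG : ∀ k, MeasurableSet (G k) := fun k => measurableSet_largeSet he _ _ _
  have hU : ∀ k, MeasurableSet (U k) := fun k =>
    measurableSet_le measurable_const (measurable_measure_inter_ball (hG k) _)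
  set w : ENNReal := ENNReal.ofReal ((2 * R) ^ n / c) * volume (Metric.ball (0 : Euc n) 1) with hw
  have hUG : ∀ k, volume (U k) ≤ w * volume (G k) := by
    intro k
    have h1 := mul_measure_le_of_density (hG k) (2 * (R * (1 / 2) ^ k))
      (ENNReal.ofReal (c * ((1 / 2) ^ k) ^ n))
    have hr : (0 : ℝ) < (1 / 2) ^ k := by positivity
    have h2 : 0 < c * ((1 / 2 : ℝ) ^ k) ^ n := by positivity
    have h3 : (2 * (R * (1 / 2) ^ k)) ^ n = c * ((1 / 2 : ℝ) ^ k) ^ n * ((2 * R) ^ n / c) := by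
      rw [← mul_assoc 2 R, mul_pow (2 * R)]
      field_simp
    rw [Measure.addHaar_ball volume (0 : Euc n) (by positivity), finrank_euclideanSpace_fin, h3,
      ENNReal.ofReal_mul h2.le, mul_assoc (ENNReal.ofReal _), ← hw,
      mul_left_comm (volume (G k))] at h1
    have h4 := (ENNReal.mul_le_mul_iff_right (ENNReal.ofReal_pos.2 h2).ne' ENNReal.ofReal_ne_top).1 h1
    exact h4.trans_eq (mul_comm _ _)
  have hpt : ∀ x ∈ {x : Euc n | 1 < ‖x‖ ∧ ‖x‖ < 2}, ENNReal.ofReal (sphExt D x ^ 2) ≤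
      ∑' k, (U k).indicator (fun _ => ENNReal.ofReal (B ^ 2) * ENNReal.ofReal ((1 / 16 : ℝ) ^ k)) x := by
    rintro x ⟨hx1, hx2⟩
    have hx0 : x ≠ 0 := by
      rintro rfl
      norm_num at hx1
    by_cases hD : sphExt D x = 0
    · simp [hD]
    rw [sphExt_of_ne_zero D hx0] at hD ⊢
    obtain ⟨k, hk1, hk2⟩ := h _ hD
    have hxU : x ∈ U k := by
      have h5 := hk2.trans (volume_largeSet_inter_ball_le e _ _ _ hx1 hx2 (by positivity))
      simp only at h5
      rwa [smul_inv_smul₀ (norm_ne_zero_iff.2 hx0)] at h5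
    refine le_trans ?_ (ENNReal.le_tsum k)
    rw [Set.indicator_of_mem hxU, ← ENNReal.ofReal_mul (by positivity)]
    refine ENNReal.ofReal_le_ofReal ?_
    have h6 : (1 / 16 : ℝ) ^ k = ((1 / 4) ^ k) ^ 2 := by
      rw [← pow_mul, mul_comm, pow_mul]; norm_num
    rw [h6, ← mul_pow, ← sq_abs]
    gcongr
  have hm : MeasurableSet {x : Euc n | 1 / 2 < ‖x‖ ∧ ‖x‖ < 4} :=
    (measurableSet_lt measurable_const measurable_norm).inter
      (measurableSet_lt measurable_norm measurable_const)
  have hm' : MeasurableSet {x : Euc n | 1 < ‖x‖ ∧ ‖x‖ < 2} :=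
    (measurableSet_lt measurable_const measurable_norm).inter
      (measurableSet_lt measurable_norm measurable_const)
  calc ∫⁻ x in {x : Euc n | 1 < ‖x‖ ∧ ‖x‖ < 2}, ENNReal.ofReal (sphExt D x ^ 2)
      ≤ ∫⁻ x in {x : Euc n | 1 < ‖x‖ ∧ ‖x‖ < 2}, ∑' k, (U k).indicator
          (fun _ => ENNReal.ofReal (B ^ 2) * ENNReal.ofReal ((1 / 16 : ℝ) ^ k)) x :=
        setLIntegral_mono' hm' hpt
    _ ≤ ∫⁻ x, ∑' k, (U k).indicator
          (fun _ => ENNReal.ofReal (B ^ 2) * ENNReal.ofReal ((1 / 16 : ℝ) ^ k)) x :=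
        setLIntegral_le_lintegral _ _
    _ = ∑' k, ENNReal.ofReal (B ^ 2) * ENNReal.ofReal ((1 / 16 : ℝ) ^ k) * volume (U k) := by
        rw [lintegral_tsum fun k => (measurable_const.indicator (hU k)).aemeasurable]
        congr 1
        ext k
        rw [lintegral_indicator (hU k), setLIntegral_const]
    _ ≤ ∑' k, ENNReal.ofReal (B ^ 2) * w * (ENNReal.ofReal ((1 / 16 : ℝ) ^ k) * volume (G k)) := by
        refine ENNReal.tsum_le_tsum fun k => ?_
        calc _ ≤ ENNReal.ofReal (B ^ 2) * ENNReal.ofReal ((1 / 16 : ℝ) ^ k) * (w * volume (G k)) := by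
              gcongr; exact hUG k
          _ = _ := by ring
    _ = ENNReal.ofReal (B ^ 2) * w * ∫⁻ x, ∑' k, (G k).indicator
          (fun _ => ENNReal.ofReal ((1 / 16 : ℝ) ^ k)) x := by
        rw [ENNReal.tsum_mul_left,
          lintegral_tsum fun k => (measurable_const.indicator (hG k)).aemeasurable]
        congr 2
        ext k
        rw [lintegral_indicator (hG k), setLIntegral_const]
    _ ≤ _ := by
        gcongr ENNReal.ofReal (B ^ 2) * w * ?_
        rw [← lintegral_indicator hm]
        refine lintegral_mono fun x => ?_
        by_cases hx : x ∈ {x : Euc n | 1 / 2 < ‖x‖ ∧ ‖x‖ < 4}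
        · rw [Set.indicator_of_mem hx]
          refine le_trans (ENNReal.tsum_le_tsum fun k => ?_) (tsum_ite_pow_le _)
          by_cases hxk : x ∈ G k
          · rw [Set.indicator_of_mem hxk, if_pos]
            have := hxk.2
            rwa [div_le_iff₀ hb, mul_comm] at this
          · rw [Set.indicator_of_notMem hxk]
            exact zero_le
        · rw [Set.indicator_of_notMem hx]
          have : ∀ k, x ∉ G k := fun k hxk => hx hxk.1
          simp [this]

/-- If around each point where `D` does not vanish there is, at a scale `r = 2⁻ᵏ` with
`D ≲ r²`, a positive proportion of points where `|e| ≳ r²`, then `‖D‖ ≲ ‖e‖` in `L²`. -/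
theorem exists_norm_le_of_density [Nontrivial (Euc n)] {R c b : ℝ} (hR : 0 ≤ R) (hc : 0 < c)
    (hb : 0 < b) (B : ℝ) :
    ∃ C : ℝ, 0 ≤ C ∧ ∀ e D : C(USphere n, ℝ), (∀ θ, D θ ≠ 0 → ∃ k : ℕ, |D θ| ≤ B * (1 / 4) ^ k ∧
      ENNReal.ofReal (c * ((1 / 2) ^ k) ^ n) ≤ volume (largeSet e (1 / 2) 2 ((1 / 4) ^ k / b) ∩
        Metric.ball (θ : Euc n) (R * (1 / 2) ^ k))) →
      ‖sphereToL2 n D‖ ≤ C * ‖sphereToL2 n e‖ := by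
  set v1 := Measure.volumeIoiPow (n - 1) {r | 1 < (r : ℝ) ∧ (r : ℝ) < 2} with hv1
  set v2 := Measure.volumeIoiPow (n - 1) {r | 1 / 2 < (r : ℝ) ∧ (r : ℝ) < 4} with hv2
  have hv1t : v1 ≠ ⊤ := volumeIoiPow_annulus_ne_top _ _ _
  have hv10 : v1 ≠ 0 := volumeIoiPow_annulus_ne_zero (by norm_num) (by norm_num)
  have hv2t : v2 ≠ ⊤ := volumeIoiPow_annulus_ne_top _ _ _
  set K : ENNReal := v1⁻¹ * (ENNReal.ofReal (B ^ 2) * (ENNReal.ofReal ((2 * R) ^ n / c) *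
        volume (Metric.ball (0 : Euc n) 1)) * ENNReal.ofReal (2 * b ^ 2) * v2) with hK
  have hKt : K ≠ ⊤ := by
    have := (measure_ball_lt_top (μ := (volume : Measure (Euc n))) (x := 0) (r := 1)).ne
    have := ENNReal.inv_ne_top.2 hv10
    finiteness
  refine ⟨Real.sqrt K.toReal, Real.sqrt_nonneg _, fun e D h => ?_⟩
  have h1 := setLIntegral_annulus_le_of_density hR hc B hb e.continuous h
  rw [setLIntegral_annulus_sphExt D.continuous (F := fun t => ENNReal.ofReal (t ^ 2))
    (by fun_prop), setLIntegral_annulus_sphExt e.continuous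
    (F := fun t => ENNReal.ofReal (2 * (b * |t|) ^ 2)) (by fun_prop), ← hv1, ← hv2] at h1
  have h2 : ∀ t : ℝ, ENNReal.ofReal (2 * (b * |t|) ^ 2) =
      ENNReal.ofReal (2 * b ^ 2) * ENNReal.ofReal (t ^ 2) := by
    intro t
    rw [← ENNReal.ofReal_mul (by positivity), mul_pow, sq_abs]
    ring_nf
  simp only [h2] at h1
  rw [lintegral_const_mul _ (by have := e.continuous; fun_prop)] at h1
  have hle : ∫⁻ θ, ENNReal.ofReal (D θ ^ 2) ∂(volume : Measure (Euc n)).toSphere ≤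
      K * ∫⁻ θ, ENNReal.ofReal (e θ ^ 2) ∂(volume : Measure (Euc n)).toSphere := by
    set X := ∫⁻ θ, ENNReal.ofReal (D θ ^ 2) ∂(volume : Measure (Euc n)).toSphere
    calc X = v1⁻¹ * (X * v1) := by
          rw [mul_comm X, ← mul_assoc, ENNReal.inv_mul_cancel hv10 hv1t, one_mul]
      _ ≤ _ := mul_le_mul_right h1 _
      _ = _ := by rw [hK]; ring
  have hle2 : ∫⁻ θ, ENNReal.ofReal (D θ ^ 2) ∂(sphereMeasure n) ≤
      K * ∫⁻ θ, ENNReal.ofReal (e θ ^ 2) ∂(sphereMeasure n) := by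
    rw [sphereMeasure, lintegral_smul_measure, lintegral_smul_measure, smul_eq_mul, smul_eq_mul,
      mul_left_comm]
    gcongr
  have hnorm : ∀ f : C(USphere n, ℝ), ∫⁻ θ, ENNReal.ofReal (f θ ^ 2) ∂(sphereMeasure n) =
      ENNReal.ofReal (‖sphereToL2 n f‖ ^ 2) := by
    intro f
    have hi : Integrable (fun θ => f θ ^ 2) (sphereMeasure n) :=
      (f.continuous.pow 2).integrable_of_hasCompactSupport (HasCompactSupport.of_compactSpace _)
    rw [norm_sphereToL2_sq, ofReal_integral_eq_lintegral_ofReal hi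
      (.of_forall fun θ => sq_nonneg _)]
  rw [hnorm, hnorm, ← ENNReal.ofReal_toReal hKt, ← ENNReal.ofReal_mul ENNReal.toReal_nonneg,
    ENNReal.ofReal_le_ofReal_iff (by positivity)] at hle2
  refine le_of_sq_le_sq ?_ (by positivity)
  rwa [mul_pow, Real.sq_sqrt ENNReal.toReal_nonneg]

end density

/-! ### Geometry of symmetric convex bodies -/

namespace SymConvexBody

variable {n : ℕ} (K : SymConvexBody n)

/-- The support function on `ℝⁿ`. -/
noncomputable def suppFun (x : Euc n) : ℝ := sSup ((fun y : Euc n => inner ℝ y x) '' K.carrier)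

theorem isGreatest_suppFun (x : Euc n) :
    IsGreatest ((fun y : Euc n => inner ℝ y x) '' K.carrier) (K.suppFun x) :=
  (K.isCompact'.image (by fun_prop)).isGreatest_sSup (K.nonempty'.image _)

theorem inner_le_suppFun {y : Euc n} (hy : y ∈ K.carrier) (x : Euc n) :
    inner ℝ y x ≤ K.suppFun x :=
  (K.isGreatest_suppFun x).2 ⟨y, hy, rfl⟩

theorem suppFun_add_le (x y : Euc n) : K.suppFun (x + y) ≤ K.suppFun x + K.suppFun y := by
  obtain ⟨z, hz, h⟩ := (K.isGreatest_suppFun (x + y)).1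
  simp only at h
  rw [← h, inner_add_right]
  exact add_le_add (K.inner_le_suppFun hz x) (K.inner_le_suppFun hz y)

theorem suppFun_smul {t : ℝ} (ht : 0 < t) (x : Euc n) :
    K.suppFun (t • x) = t * K.suppFun x := by
  refine (K.isGreatest_suppFun (t • x)).unique ⟨?_, ?_⟩
  · obtain ⟨z, hz, h⟩ := (K.isGreatest_suppFun x).1
    exact ⟨z, hz, by simp only at h ⊢; rw [inner_smul_right, h]⟩
  · rintro _ ⟨z, hz, rfl⟩
    simp only
    rw [inner_smul_right]
    exact mul_le_mul_of_nonneg_left (K.inner_le_suppFun hz x) ht.le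

theorem suppFun_eq_norm_mul {x : Euc n} (hx : x ≠ 0) :
    K.suppFun x = ‖x‖ * sphExt K.supp x := by
  rw [sphExt_of_ne_zero _ hx]
  change K.suppFun x = ‖x‖ * K.suppFun (‖x‖⁻¹ • x)
  rw [← K.suppFun_smul (norm_pos_iff.2 hx), smul_inv_smul₀ (norm_ne_zero_iff.2 hx)]

theorem radial_pos (θ : USphere n) : 0 < K.radial θ := (K.isGreatest_radial θ).1.1

theorem radial_smul_mem (θ : USphere n) : K.radial θ • (θ : Euc n) ∈ K.carrier :=
  (K.isGreatest_radial θ).1.2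

theorem radial_le_supp (θ : USphere n) : K.radial θ ≤ K.supp θ := by
  have h := K.inner_le_suppFun (K.radial_smul_mem θ) θ
  rwa [real_inner_smul_left, real_inner_self_eq_norm_sq, norm_eq_of_mem_sphere, one_pow,
    mul_one] at h

theorem norm_le_radial {x : Euc n} (hx : x ∈ K.carrier) (hx0 : x ≠ 0) :
    ‖x‖ ≤ K.radial ⟨‖x‖⁻¹ • x, by simp [norm_smul, hx0]⟩ := by
  refine (K.isGreatest_radial _).2 ⟨norm_pos_iff.2 hx0, ?_⟩
  simpa [smul_inv_smul₀ (norm_ne_zero_iff.2 hx0)] using hx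

theorem norm_le_of_radial_le {r : ℝ} (hr : 0 ≤ r) (h : ∀ θ, K.radial θ ≤ r) {x : Euc n}
    (hx : x ∈ K.carrier) : ‖x‖ ≤ r := by
  rcases eq_or_ne x 0 with rfl | hx0
  · simpa using hr
  · exact (K.norm_le_radial hx hx0).trans (h _)

theorem supp_le_of_radial_le {r : ℝ} (hr : 0 ≤ r) (h : ∀ θ, K.radial θ ≤ r) (θ : USphere n) :
    K.supp θ ≤ r := by
  obtain ⟨z, hz, h1⟩ := (K.isGreatest_supp θ).1
  simp only at h1
  rw [← h1]
  refine (real_inner_le_norm _ _).trans ?_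
  rw [norm_eq_of_mem_sphere, mul_one]
  exact K.norm_le_of_radial_le hr h hz

theorem eq_closedBall_of_radial_eq {r : ℝ} (hr : 0 < r) (h : ∀ θ, K.radial θ = r) :
    K.carrier = Metric.closedBall (0 : Euc n) r := by
  ext x
  rw [mem_closedBall_zero_iff]
  refine ⟨K.norm_le_of_radial_le hr.le fun θ => (h θ).le, fun hx => ?_⟩
  have h0 : (0 : Euc n) ∈ K.carrier := mem_of_mem_nhds K.carrier_mem_nhds
  rcases eq_or_ne x 0 with rfl | hx0
  · exact h0
  · have h1 := K.radial_smul_mem ⟨‖x‖⁻¹ • x, by simp [norm_smul, hx0]⟩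
    rw [h] at h1
    have h2 := K.convex'.smul_mem_of_zero_mem h0 h1 (t := ‖x‖ / r)
      ⟨by positivity, (div_le_one hr).2 hx⟩
    rwa [smul_smul, div_mul_cancel₀ _ hr.ne', smul_inv_smul₀ (norm_ne_zero_iff.2 hx0)] at h2

/-- There is a supporting hyperplane at each radial boundary point. -/
theorem exists_supp_eq_inner_radial (φ : USphere n) :
    ∃ θ : USphere n, K.supp θ = K.radial φ * inner ℝ (φ : Euc n) (θ : Euc n) := by
  set p : Euc n := K.radial φ • (φ : Euc n) with hp
  have hpi : p ∉ interior K.carrier := by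
    intro h
    -- From an interior point one could move further out along the ray, against maximality of the
    -- radial function.
    have h1 : ∀ᶠ t in 𝓝 (K.radial φ), t • (φ : Euc n) ∈ K.carrier := by
      have hc : Continuous fun t : ℝ => t • (φ : Euc n) := by fun_prop
      exact hc.continuousAt.eventually_mem (mem_interior_iff_mem_nhds.1 h)
    obtain ⟨t, ht, htK⟩ := h1.exists_gt
    exact ht.not_ge ((K.isGreatest_radial φ).2 ⟨(K.radial_pos φ).trans ht, htK⟩)
  obtain ⟨f, hf⟩ := geometric_hahn_banach_open_point K.convex'.interior isOpen_interior hpi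
  -- Separation holds on the interior, and K lies in the closure of its interior.
  have hfle : ∀ y ∈ K.carrier, f y ≤ f p := by
    intro y hy
    have h1 : y ∈ closure (interior K.carrier) := by
      rw [K.convex'.closure_interior_eq_closure_of_nonempty_interior K.interior_nonempty]
      exact subset_closure hy
    exact closure_minimal (fun a ha => (hf a ha).le) (isClosed_le f.continuous continuous_const) h1
  set w := (InnerProductSpace.toDual ℝ (Euc n)).symm f with hw
  have hfw : ∀ y, f y = inner ℝ y w := by
    intro y
    rw [real_inner_comm, hw, InnerProductSpace.toDual_symm_apply]
  have hw0 : w ≠ 0 := by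
    intro h0
    have h1 := hf 0 (mem_interior_iff_mem_nhds.2 K.carrier_mem_nhds)
    rw [hfw, hfw, h0, inner_zero_right, inner_zero_right] at h1
    exact lt_irrefl _ h1
  refine ⟨⟨‖w‖⁻¹ • w, by simp [norm_smul, hw0]⟩, (K.isGreatest_supp _).unique ⟨?_, ?_⟩⟩
  · refine ⟨p, K.radial_smul_mem φ, ?_⟩
    simp only [hp, real_inner_smul_left]
  · rintro _ ⟨y, hy, rfl⟩
    have h1 := hfle y hy
    rw [hfw, hfw, hp, real_inner_smul_left] at h1
    simp only [inner_smul_right]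
    rw [mul_left_comm]
    gcongr

end SymConvexBody

/-! ### From a dip of the radial function to a large set for the support function -/

section dip

variable {n : ℕ}

theorem inner_sphere_eq (θ φ : USphere n) :
    inner ℝ (φ : Euc n) (θ : Euc n) = 1 - dist θ φ ^ 2 / 2 := by
  have h := norm_sub_sq_real (φ : Euc n) θ
  rw [norm_eq_of_mem_sphere, norm_eq_of_mem_sphere, ← dist_eq_norm, dist_comm] at h
  rw [Subtype.dist_eq]
  linarith

theorem dist_normalize_le {x y : Euc n} (hx : x ≠ 0) (hy : y ≠ 0) :
    ‖y‖ * dist (‖x‖⁻¹ • x) (‖y‖⁻¹ • y) ≤ 2 * dist x y := by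
  have hx' : ‖x‖ ≠ 0 := norm_ne_zero_iff.2 hx
  have hy' : ‖y‖ ≠ 0 := norm_ne_zero_iff.2 hy
  have h1 : ‖y‖ • (‖x‖⁻¹ • x - ‖y‖⁻¹ • y) = (‖y‖ - ‖x‖) • (‖x‖⁻¹ • x) + (x - y) := by
    rw [smul_sub, smul_inv_smul₀ hy', sub_smul, smul_inv_smul₀ hx']
    abel
  have h2 : ‖y‖ * dist (‖x‖⁻¹ • x) (‖y‖⁻¹ • y) = ‖‖y‖ • (‖x‖⁻¹ • x - ‖y‖⁻¹ • y)‖ := by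
    rw [norm_smul, norm_norm, dist_eq_norm]
  rw [h2, h1]
  refine (norm_add_le _ _).trans ?_
  have h3 : ‖‖x‖⁻¹ • x‖ = 1 := by rw [norm_smul, norm_inv, norm_norm, inv_mul_cancel₀ hx']
  rw [norm_smul, h3, mul_one, dist_eq_norm, Real.norm_eq_abs]
  have h4 := abs_norm_sub_norm_le y x
  rw [norm_sub_rev] at h4
  linarith

/-- For the extension of degree 1, the change of norm costs Λ and the change of direction 2Λ. -/
theorem abs_norm_mul_sphExt_sub_le {g : USphere n → ℝ} {Λ : ℝ} (hΛ : 0 ≤ Λ)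
    (hg : ∀ θ, |g θ| ≤ Λ) (hg' : ∀ θ φ, |g θ - g φ| ≤ Λ * dist θ φ) {x y : Euc n} (hx : x ≠ 0)
    (hy : y ≠ 0) : |‖x‖ * sphExt g x - ‖y‖ * sphExt g y| ≤ 3 * Λ * dist x y := by
  rw [sphExt_of_ne_zero g hx, sphExt_of_ne_zero g hy]
  set θ : USphere n := ⟨‖x‖⁻¹ • x, by simp [norm_smul, hx]⟩
  set φ : USphere n := ⟨‖y‖⁻¹ • y, by simp [norm_smul, hy]⟩
  have h1 : ‖x‖ * g θ - ‖y‖ * g φ = (‖x‖ - ‖y‖) * g θ + ‖y‖ * (g θ - g φ) := by ring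
  rw [h1]
  refine (abs_add_le _ _).trans ?_
  rw [abs_mul, abs_mul, abs_of_nonneg (norm_nonneg y)]
  have h2 : |‖x‖ - ‖y‖| * |g θ| ≤ dist x y * Λ := by
    rw [dist_eq_norm]
    exact mul_le_mul (abs_norm_sub_norm_le x y) (hg θ) (abs_nonneg _) (norm_nonneg _)
  have h3 : ‖y‖ * |g θ - g φ| ≤ Λ * (2 * dist x y) := by
    calc ‖y‖ * |g θ - g φ| ≤ ‖y‖ * (Λ * dist θ φ) := by gcongr; exact hg' θ φ
      _ = Λ * (‖y‖ * dist (‖x‖⁻¹ • x) (‖y‖⁻¹ • y)) := by rw [Subtype.dist_eq]; ring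
      _ ≤ _ := mul_le_mul_of_nonneg_left (dist_normalize_le hx hy) hΛ
  linarith

variable (K : SymConvexBody n)

/-- If the radial function falls below `κ + g` at `φ`, then the support function falls below
`κ + g` at a nearby point. -/
theorem exists_supp_dip {κ Λ : ℝ} {g : USphere n → ℝ} (hκ : 1 / 2 ≤ κ)
    (hΛ' : Λ ≤ 1 / 8) (hg : ∀ θ, |g θ| ≤ Λ) (hg' : ∀ θ φ, |g θ - g φ| ≤ Λ * dist θ φ)
    (hr : ∀ θ, 3 / 4 ≤ K.radial θ ∧ K.radial θ ≤ 5 / 4) (φ : USphere n)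
    (ha : 0 ≤ κ + g φ - K.radial φ) :
    ∃ θ : USphere n, K.supp θ - κ - g θ ≤
      -(κ + g φ - K.radial φ) / 2 - dist θ φ ^ 2 / 8 + 4 * Λ ^ 2 := by
  obtain ⟨θ, hθ⟩ := K.exists_supp_eq_inner_radial φ
  refine ⟨θ, ?_⟩
  have h1 : 3 / 4 ≤ K.supp θ := (hr θ).1.trans (K.radial_le_supp θ)
  set t := inner ℝ (φ : Euc n) (θ : Euc n) with ht
  have ht1 : 1 / 2 ≤ t := by
    rw [hθ] at h1
    nlinarith [hr φ]
  have htd : t = 1 - dist θ φ ^ 2 / 2 := inner_sphere_eq θ φ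
  set d := dist θ φ with hd
  have h2 := abs_le.1 (hg φ)
  have h3 := abs_le.1 (hg' θ φ)
  set a := κ + g φ - K.radial φ with hadef
  have h4 : K.radial φ = κ + g φ - a := by rw [hadef]; ring
  have h5 : K.supp θ - κ - g θ = -(a * t) - κ * (d ^ 2 / 2) - (g θ - g φ) - g φ * (d ^ 2 / 2) := by
    rw [hθ, h4, htd]; ring
  rw [h5]
  have h6 : a / 2 ≤ a * t := by nlinarith
  have h7 : 1 / 2 * (d ^ 2 / 2) ≤ κ * (d ^ 2 / 2) := by gcongr
  have h8 : -(1 / 8) * (d ^ 2 / 2) ≤ g φ * (d ^ 2 / 2) := by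
    have : 0 ≤ d ^ 2 / 2 := by positivity
    nlinarith
  -- The Lipschitz loss is absorbed by Λd ≤ d²/16 + 4Λ²; of the gain d²/4 - d²/32·2, an amount d²/8
  -- survives.
  nlinarith [sq_nonneg (d / 4 - 2 * Λ)]

/-- Around a dip of `h_K - κ - g` of depth `E`, convexity makes `h_K - κ - g` large in size. -/
theorem large_or_large_of_dip {κ Λ E : ℝ} {g : USphere n → ℝ} (hκ : κ ≤ 3 / 2) (hκ0 : 0 ≤ κ)
    (hΛ : 0 ≤ Λ) (hg : ∀ θ, |g θ| ≤ Λ) (hg' : ∀ θ φ, |g θ - g φ| ≤ Λ * dist θ φ)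
    {θ : USphere n} (hE0 : 0 < E) (hE : K.supp θ - κ - g θ ≤ -E) (hΛE : 72 * Λ ^ 2 ≤ E)
    {v : Euc n} (hv : ‖v‖ ^ 2 ≤ E / 32) (hv' : ‖v‖ ≤ 1 / 8) :
    E / 16 ≤ |sphExt (fun θ => K.supp θ - κ - g θ) ((θ : Euc n) + v)| ∨
      E / 16 ≤ |sphExt (fun θ => K.supp θ - κ - g θ) ((θ : Euc n) + (2 : ℝ) • v)| := by
  by_contra! hcon
  obtain ⟨hc1, hc2⟩ := hcon
  set x := (θ : Euc n) + v with hxdef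
  set z := (θ : Euc n) + (2 : ℝ) • v with hzdef
  have hθ1 : ‖(θ : Euc n)‖ = 1 := norm_eq_of_mem_sphere θ
  have h2v : ‖(2 : ℝ) • v‖ = 2 * ‖v‖ := by rw [norm_smul]; norm_num
  have hx2 : ‖x‖ ≤ 2 := (norm_add_le _ _).trans (by linarith)
  have hz2 : ‖z‖ ≤ 2 := (norm_add_le _ _).trans (by linarith)
  have hx0 : x ≠ 0 := by
    intro h0
    have : (θ : Euc n) = -v := eq_neg_of_add_eq_zero_left h0
    rw [this, norm_neg] at hθ1
    linarith
  have hz0 : z ≠ 0 := by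
    intro h0
    have : (θ : Euc n) = -((2 : ℝ) • v) := eq_neg_of_add_eq_zero_left h0
    rw [this, norm_neg] at hθ1
    linarith
  have hθ0 : (θ : Euc n) ≠ 0 := ne_zero_of_mem_unit_sphere θ
  have hexp : ∀ y : Euc n, y ≠ 0 → K.suppFun y =
      ‖y‖ * κ + ‖y‖ * sphExt g y + ‖y‖ * sphExt (fun θ => K.supp θ - κ - g θ) y := by
    intro y hy
    rw [K.suppFun_eq_norm_mul hy, sphExt_of_ne_zero _ hy, sphExt_of_ne_zero _ hy,
      sphExt_of_ne_zero _ hy]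
    ring
  -- The point x is the midpoint of θ and z. If e were small at both x and z, the depth E at θ would
  -- violate sublinearity.
  have hconv : 2 * K.suppFun x ≤ K.suppFun θ + K.suppFun z := by
    have h1 : (2 : ℝ) • x = (θ : Euc n) + z := by
      rw [hxdef, hzdef, smul_add, two_smul ℝ (θ : Euc n), add_assoc]
    rw [← K.suppFun_smul two_pos, h1]
    exact K.suppFun_add_le _ _
  rw [hexp x hx0, hexp z hz0, hexp θ hθ0, sphExt_coe, sphExt_coe, hθ1] at hconv
  have hGx := abs_le.1 (abs_norm_mul_sphExt_sub_le hΛ hg hg' hθ0 hx0)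
  have hGz := abs_le.1 (abs_norm_mul_sphExt_sub_le hΛ hg hg' hz0 hx0)
  have hd1 : dist (θ : Euc n) x = ‖v‖ := by rw [hxdef, dist_self_add_right]
  have hd2 : dist z x = ‖v‖ := by
    rw [hzdef, hxdef, dist_add_left, dist_eq_norm, two_smul, add_sub_cancel_right]
  rw [hd1, sphExt_coe, hθ1] at hGx
  rw [hd2] at hGz
  -- In the second difference of the norm the terms linear in v cancel, so the constant κ
  -- contributes only O(|v|²).
  have hxn : 1 + inner ℝ (θ : Euc n) v ≤ ‖x‖ := by
    have := real_inner_le_norm (θ : Euc n) x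
    rw [hθ1, one_mul, hxdef, inner_add_right, real_inner_self_eq_norm_sq, hθ1] at this
    linarith
  have hzn : ‖z‖ ≤ 1 + 2 * inner ℝ (θ : Euc n) v + 2 * ‖v‖ ^ 2 := by
    have h1 := norm_add_sq_real (θ : Euc n) ((2 : ℝ) • v)
    rw [← hzdef, hθ1, h2v, inner_smul_right] at h1
    nlinarith [sq_nonneg (‖z‖ - 1)]
  have hκz : κ * (1 + ‖z‖ - 2 * ‖x‖) ≤ κ * (2 * ‖v‖ ^ 2) := by
    gcongr; linarith
  have hκ2 : κ * (2 * ‖v‖ ^ 2) ≤ 3 / 2 * (2 * ‖v‖ ^ 2) := by gcongr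
  have h9 : 6 * Λ * ‖v‖ ≤ 9 * Λ ^ 2 + ‖v‖ ^ 2 := by nlinarith [sq_nonneg (3 * Λ - ‖v‖)]
  have hex : -(2 * (E / 16)) ≤ ‖x‖ * sphExt (fun θ => K.supp θ - κ - g θ) x := by
    have := (abs_lt.1 hc1).1
    nlinarith [norm_nonneg x]
  have hez : ‖z‖ * sphExt (fun θ => K.supp θ - κ - g θ) z ≤ 2 * (E / 16) := by
    have := (abs_lt.1 hc2).2
    nlinarith [norm_nonneg z]
  -- Altogether 10E/16 ≤ 4|v|² + 9Λ², while the right side is at most E/8 + E/8.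
  nlinarith

/-- The ball is covered by a translate of G and a halved translate, each of volume at most that of
G. -/
theorem half_volume_ball_le_of_subset {G : Set (Euc n)} (x : Euc n) {s : ℝ}
    (h : ∀ v : Euc n, ‖v‖ < s → x + v ∈ G ∨ x + (2 : ℝ) • v ∈ G) :
    volume (Metric.ball (0 : Euc n) s) ≤ 2 * volume G := by
  have h1 : Metric.ball (0 : Euc n) s ⊆ (fun v => x + v) ⁻¹' G ∪
      (fun v => (2 : ℝ) • v) ⁻¹' ((fun v => x + v) ⁻¹' G) := by
    intro v hv
    exact h v (by simpa using hv)
  refine (measure_mono h1).trans ((measure_union_le _ _).trans ?_)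
  rw [Measure.addHaar_preimage_smul volume two_ne_zero, measure_preimage_add, two_mul]
  refine add_le_add le_rfl (mul_le_of_le_one_left zero_le ?_)
  rw [ENNReal.ofReal_le_one, abs_of_nonneg (by positivity)]
  exact inv_le_one_of_one_le₀ (one_le_pow₀ (by norm_num))

theorem density_of_radial_lt {κ Λ : ℝ} {g : USphere n → ℝ} (hκ : 1 / 2 ≤ κ) (hκ' : κ ≤ 3 / 2)
    (hΛ : 0 ≤ Λ) (hΛ' : Λ ≤ 1 / 8) (hg : ∀ θ, |g θ| ≤ Λ)
    (hg' : ∀ θ φ, |g θ - g φ| ≤ Λ * dist θ φ)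
    (hr : ∀ θ, 3 / 4 ≤ K.radial θ ∧ K.radial θ ≤ 5 / 4)
    (he : ∀ θ, |K.supp θ - κ - g θ| ≤ 1) (φ : USphere n)
    (hφ : 288 * Λ ^ 2 < κ + g φ - K.radial φ) :
    ∃ k : ℕ, κ + g φ - K.radial φ ≤ 4 * (1 / 4) ^ k ∧
      ENNReal.ofReal ((volume : Measure (Euc n)).real (Metric.ball 0 1) / (2 * 16 ^ n) *
          ((1 / 2) ^ k) ^ n) ≤
        volume (largeSet (fun θ => K.supp θ - κ - g θ) (1 / 2) 2 ((1 / 4) ^ k / 64) ∩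
          Metric.ball (φ : Euc n) (4 * (1 / 2) ^ k)) := by
  have ha : 0 < κ + g φ - K.radial φ := lt_of_le_of_lt (by positivity) hφ
  obtain ⟨θ, hθ⟩ := exists_supp_dip K hκ hΛ' hg hg' hr φ ha.le
  set a := κ + g φ - K.radial φ
  set E := -(K.supp θ - κ - g θ) with hEdef
  -- Since a > 288Λ², the error 4Λ² is absorbed by a/4. The same threshold gives E ≥ a/4 > 72Λ², as
  -- `large_or_large_of_dip` requires.
  have hEd : a / 4 + dist θ φ ^ 2 / 8 ≤ E := by nlinarith
  have hEa : a / 4 ≤ E := by nlinarith [sq_nonneg (dist θ φ)]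
  have hE0 : 0 < E := by linarith
  have hE1 : E ≤ 1 := by linarith [(abs_le.1 (he θ)).1]
  -- The scale r = 2⁻ᵏ satisfies r²/4 < E ≤ r². Hence a ≤ 4r², |θ - φ| < 3r and E/16 ≥ r²/64, and a
  -- ball of radius r/8 at θ stays within 4r of φ.
  obtain ⟨k, hk1, hk2⟩ := exists_nat_pow_near_of_lt_one hE0 hE1 (y := (1 / 4 : ℝ)) (by norm_num)
    (by norm_num)
  refine ⟨k, by linarith, ?_⟩
  set r : ℝ := (1 / 2) ^ k with hrdef
  have hr0 : 0 < r := by positivity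
  have hr1 : r ≤ 1 := pow_le_one₀ (by norm_num) (by norm_num)
  have hr2 : (1 / 4 : ℝ) ^ k = r ^ 2 := by rw [hrdef, ← pow_mul, mul_comm, pow_mul]; norm_num
  rw [pow_succ, hr2] at hk1
  rw [hr2] at hk2 ⊢
  set e : USphere n → ℝ := fun θ => K.supp θ - κ - g θ with he_def
  have hd : dist (θ : Euc n) φ < 3 * r := by
    have h1 : dist (θ : Euc n) φ = dist θ φ := (Subtype.dist_eq θ φ).symm
    rw [h1]
    refine lt_of_pow_lt_pow_left₀ 2 (by positivity) ?_
    nlinarith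
  have hθ1 : ‖(θ : Euc n)‖ = 1 := norm_eq_of_mem_sphere θ
  have hmem : ∀ u : Euc n, ‖u‖ < r / 8 → E / 16 ≤ |sphExt e ((θ : Euc n) + u)| →
      (θ : Euc n) + u ∈ largeSet e (1 / 2) 2 (r ^ 2 / 64) ∩ Metric.ball (φ : Euc n) (4 * r) := by
    intro u hu hue
    refine ⟨⟨⟨?_, ?_⟩, ?_⟩, ?_⟩
    · have h1 := norm_sub_le ((θ : Euc n) + u) u
      rw [add_sub_cancel_right, hθ1] at h1
      linarith
    · have := norm_add_le (θ : Euc n) u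
      linarith
    · linarith
    · rw [Metric.mem_ball]
      have h1 := dist_triangle ((θ : Euc n) + u) θ φ
      rw [dist_self_add_left] at h1
      linarith
  have hball := half_volume_ball_le_of_subset
    (G := largeSet e (1 / 2) 2 (r ^ 2 / 64) ∩ Metric.ball (φ : Euc n) (4 * r))
    (θ : Euc n) (s := r / 16) (by
      intro v hv
      have h2v : ‖(2 : ℝ) • v‖ = 2 * ‖v‖ := by rw [norm_smul]; norm_num
      have hv2 : ‖v‖ ^ 2 ≤ E / 32 := by nlinarith [norm_nonneg v]
      rcases large_or_large_of_dip K hκ' (by linarith) hΛ hg hg' (θ := θ) hE0 (by rw [hEdef, neg_neg])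
        (by linarith) hv2 (by linarith) with h | h
      · exact Or.inl (hmem v (by linarith) h)
      · exact Or.inr (hmem _ (by linarith) h))
  have h2 : ∀ t : ℝ, 0 ≤ t → ENNReal.ofReal t * 2 = ENNReal.ofReal (t * 2) := fun t ht => by
    rw [ENNReal.ofReal_mul ht, ENNReal.ofReal_ofNat]
  have h3 : ENNReal.ofReal ((volume : Measure (Euc n)).real (Metric.ball 0 1) / (2 * 16 ^ n) *
      r ^ n) * 2 = volume (Metric.ball (0 : Euc n) (r / 16)) := by
    rw [Measure.addHaar_ball_of_pos volume (0 : Euc n) (by positivity : 0 < r / 16),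
      finrank_euclideanSpace_fin, ← ENNReal.ofReal_toReal (measure_ball_lt_top.ne :
        volume (Metric.ball (0 : Euc n) 1) ≠ ⊤), ← ENNReal.ofReal_mul (by positivity),
      h2 _ (by positivity), div_pow]
    congr 1
    rw [measureReal_def]
    field_simp
  rw [← h3, mul_comm] at hball
  exact (ENNReal.mul_le_mul_iff_right two_ne_zero ENNReal.ofNat_ne_top).1 hball

end dip

/-! ### The L² comparison of radial and support functions, and rigidity -/

section assembly

variable {n : ℕ}

/-- The key comparison: up to a quadratic error, the radial function is as close to `κ + g` in `L²`
as the support function is. -/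
theorem exists_norm_radial_sub_le [Nontrivial (Euc n)] :
    ∃ C : ℝ, 0 ≤ C ∧ ∀ (K : SymConvexBody n) (κ Λ : ℝ) (g : C(USphere n, ℝ)), 1 / 2 ≤ κ →
      κ ≤ 3 / 2 → 0 ≤ Λ → Λ ≤ 1 / 8 → (∀ θ, |g θ| ≤ Λ) →
      (∀ θ φ, |g θ - g φ| ≤ Λ * dist θ φ) →
      (∀ θ, 3 / 4 ≤ K.radial θ ∧ K.radial θ ≤ 5 / 4) → (∀ θ, |K.supp θ - κ - g θ| ≤ 1) →
      ‖K.radialL2 - sphereToL2 n (ContinuousMap.const _ κ) - sphereToL2 n g‖ ≤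
        C * ‖K.suppL2 - sphereToL2 n (ContinuousMap.const _ κ) - sphereToL2 n g‖ +
          288 * Λ ^ 2 := by
  have hc : 0 < (volume : Measure (Euc n)).real (Metric.ball 0 1) / (2 * 16 ^ n) := by
    have : 0 < (volume : Measure (Euc n)).real (Metric.ball 0 1) :=
      ENNReal.toReal_pos (Metric.measure_ball_pos _ _ one_pos).ne' measure_ball_lt_top.ne
    positivity
  obtain ⟨C, hC, hCD⟩ := exists_norm_le_of_density (n := n) (R := 4) (by norm_num) hc
    (b := 64) (by norm_num) 4
  refine ⟨1 + C, by positivity, fun K κ Λ g hκ hκ' hΛ hΛ' hg hg' hr he => ?_⟩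
  let ρ : C(USphere n, ℝ) := ⟨K.radial, K.continuous_radial⟩
  let h : C(USphere n, ℝ) := ⟨K.supp, K.continuous_supp⟩
  let e : C(USphere n, ℝ) := h - ContinuousMap.const _ κ - g
  let D : C(USphere n, ℝ) := ⟨fun θ => max 0 (κ + g θ - K.radial θ - 288 * Λ ^ 2), by
    have := K.continuous_radial
    fun_prop⟩
  have hD : ‖sphereToL2 n D‖ ≤ C * ‖sphereToL2 n e‖ := by
    refine hCD e D fun θ hθ => ?_
    have h1 : 0 < κ + g θ - K.radial θ - 288 * Λ ^ 2 := by
      by_contra! hcon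
      exact hθ (max_eq_left hcon)
    have h2 : D θ = κ + g θ - K.radial θ - 288 * Λ ^ 2 := max_eq_right h1.le
    obtain ⟨k, hk1, hk2⟩ := density_of_radial_lt K hκ hκ' hΛ hΛ' hg hg' hr he θ (by linarith)
    refine ⟨k, ?_, hk2⟩
    rw [h2, abs_of_pos h1]
    linarith [sq_nonneg Λ]
  -- Pointwise |ρ - κ - g| ≤ |e| + D + 288Λ²: above because ρ ≤ h, below by the definition of D.
  have hle : ‖sphereToL2 n (ρ - ContinuousMap.const _ κ - g)‖ ≤
      ‖sphereToL2 n (⟨fun θ => |e θ|, by fun_prop⟩ + D + ContinuousMap.const _ (288 * Λ ^ 2))‖ := by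
    refine norm_sphereToL2_mono fun θ => ?_
    have h1 : D θ = max 0 (κ + g θ - K.radial θ - 288 * Λ ^ 2) := rfl
    have h2 : e θ = K.supp θ - κ - g θ := rfl
    have h3 : (ρ - ContinuousMap.const _ κ - g : C(USphere n, ℝ)) θ = K.radial θ - κ - g θ := rfl
    simp only [ContinuousMap.add_apply, ContinuousMap.coe_mk, ContinuousMap.const_apply]
    rw [h1, h2, h3, abs_le]
    have h4 := K.radial_le_supp θ
    have h5 := le_max_left 0 (κ + g θ - K.radial θ - 288 * Λ ^ 2)
    have h6 := le_max_right 0 (κ + g θ - K.radial θ - 288 * Λ ^ 2)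
    have h7 := le_abs_self (K.supp θ - κ - g θ)
    have h8 := abs_nonneg (K.supp θ - κ - g θ)
    have h9 := sq_nonneg Λ
    constructor <;> linarith
  have habs : ‖sphereToL2 n ⟨fun θ => |e θ|, by fun_prop⟩‖ ≤ ‖sphereToL2 n e‖ := by
    refine le_of_sq_le_sq (le_of_eq ?_) (norm_nonneg _)
    rw [norm_sphereToL2_sq, norm_sphereToL2_sq]
    simp
  have hconst : ‖sphereToL2 n (ContinuousMap.const _ (288 * Λ ^ 2))‖ = 288 * Λ ^ 2 := by
    have h1 : (ContinuousMap.const _ (288 * Λ ^ 2) : C(USphere n, ℝ)) = (288 * Λ ^ 2) • 1 := by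
      ext θ; simp
    rw [h1, map_smul, norm_smul, norm_sphereToL2_one, mul_one, Real.norm_of_nonneg (by positivity)]
  rw [map_add, map_add] at hle
  have hρ : sphereToL2 n (ρ - ContinuousMap.const _ κ - g) =
      K.radialL2 - sphereToL2 n (ContinuousMap.const _ κ) - sphereToL2 n g := by
    rw [map_sub, map_sub]; rfl
  have hh : sphereToL2 n e = K.suppL2 - sphereToL2 n (ContinuousMap.const _ κ) - sphereToL2 n g := by
    rw [map_sub, map_sub]; rfl
  rw [← hρ, ← hh]
  refine hle.trans ((norm_add₃_le).trans ?_)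
  rw [hconst]
  linarith

theorem integral_mem_Icc_of_forall [Nontrivial (Euc n)] {f : C(USphere n, ℝ)} {a b : ℝ}
    (h : ∀ θ, a ≤ f θ ∧ f θ ≤ b) : ∫ θ, f θ ∂(sphereMeasure n) ∈ Set.Icc a b := by
  have hi : Integrable f (sphereMeasure n) :=
    f.continuous.integrable_of_hasCompactSupport (HasCompactSupport.of_compactSpace _)
  constructor
  · simpa using integral_mono (integrable_const a) hi fun θ => (h θ).1
  · simpa using integral_mono hi (integrable_const b) fun θ => (h θ).2

theorem norm_sphereToL2_le_of_forall [Nontrivial (Euc n)] {f : C(USphere n, ℝ)} {a : ℝ}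
    (h : ∀ θ, |f θ| ≤ a) : ‖sphereToL2 n f‖ ≤ a := by
  obtain ⟨x, hx⟩ := exists_norm_eq (Euc n) (c := 1) zero_le_one
  have ha : 0 ≤ a := (abs_nonneg _).trans (h ⟨x, by simpa using hx⟩)
  refine (norm_sphereToL2_mono (g := a • 1) fun θ => by simpa using h θ).trans ?_
  rw [map_smul, norm_smul, norm_sphereToL2_one, mul_one, Real.norm_of_nonneg ha]

theorem SymConvexBody.exists_eq_of_radialL2_eq [Nontrivial (Euc n)] (K : SymConvexBody n)
    (h : K.radialL2 = harmonicTerm n 0 K.radialL2) :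
    ∃ r : ℝ, 0 < r ∧ (∀ θ : USphere n, K.supp θ = r ∧ K.radial θ = r) ∧
      K.carrier = Metric.closedBall (0 : Euc n) r := by
  rw [SymConvexBody.radialL2, harmonicTerm_zero_sphereToL2] at h
  have h1 := sphereToL2_injective h
  set r := ∫ θ, (⟨K.radial, K.continuous_radial⟩ : C(USphere n, ℝ)) θ ∂(sphereMeasure n)
  have h2 : ∀ θ, K.radial θ = r := fun θ => DFunLike.congr_fun h1 θ
  obtain ⟨x, hx⟩ := exists_norm_eq (Euc n) (c := 1) zero_le_one
  have hr : 0 < r := by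
    rw [← h2 ⟨x, by simpa using hx⟩]
    exact K.radial_pos _
  refine ⟨r, hr, fun θ => ⟨le_antisymm ?_ ?_, h2 θ⟩, K.eq_closedBall_of_radial_eq hr h2⟩
  · exact K.supp_le_of_radial_le hr.le (fun θ => (h2 θ).le) θ
  · rw [← h2 θ]
    exact K.radial_le_supp θ

end assembly

theorem lemma3 (n : ℕ) (hn : 2 ≤ n) (M : SphereL2 n →L[ℝ] SphereL2 n)
    (hM : IsStrongContraction M) :
    ∃ δ : ℝ, 0 < δ ∧ δ < 1 ∧
      ∀ (K : SymConvexBody n) (c : ℝ), c ∈ Set.Ioo (1 - δ) (1 + δ) →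
        (∀ θ : USphere n, 1 - δ ≤ K.radial θ ∧ K.radial θ ≤ 1 + δ) →
        ‖(K.suppL2 - harmonicTerm n 0 K.suppL2)
            - c • M (K.radialL2 - harmonicTerm n 0 K.radialL2)‖
          ≤ δ * ‖K.radialL2 - harmonicTerm n 0 K.radialL2‖ →
        ∃ r : ℝ, 0 < r ∧ (∀ θ : USphere n, K.supp θ = r ∧ K.radial θ = r) ∧
          K.carrier = Metric.closedBall (0 : Euc n) r := by
  have : NeZero n := ⟨by omega⟩
  obtain ⟨C, hC, key⟩ := exists_norm_radial_sub_le (n := n)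
  obtain ⟨q, hq0, hq1, happrox⟩ := hM.exists_approx
  have hq : 0 < 1 - q := by linarith
  -- The truncation error, multiplied by the comparison constant C, must use only a fraction of the
  -- gap 1 - q. N and Λ depend on η, so δ is chosen after them.
  set η := (1 - q) / (16 * (1 + C)) with hη
  have hη0 : 0 < η := by positivity
  have hηC : C * η ≤ (1 - q) / 16 := by
    rw [hη, mul_div_assoc', div_le_div_iff₀ (by positivity) (by norm_num)]
    nlinarith
  obtain ⟨N, hN⟩ := happrox η hη0
  obtain ⟨Λ, hΛ0, hΛ⟩ := exists_lipschitz_of_finiteDimensional (⨆ m : Fin N, sphHarmonic n m)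
    (iSup_sphHarmonic_le_range N)
  -- The four bounds serve, in order, the hypothesis error, the factor c in cq, the ranges of κ, ρ
  -- and h, and the quadratic term 288(Λ‖g‖)², where one factor ε ≤ δ is traded for smallness.
  set δ := min (min η ((1 - q) / 16)) (min (1 / 16) ((1 - q) / (10000 * (1 + Λ) ^ 2))) with hδ
  have hδ0 : 0 < δ := by positivity
  have hδη : δ ≤ η := (min_le_left _ _).trans (min_le_left _ _)
  have hδq : δ ≤ (1 - q) / 16 := (min_le_left _ _).trans (min_le_right _ _)
  have hδ16 : δ ≤ 1 / 16 := (min_le_right _ _).trans (min_le_left _ _)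
  have hδΛ : δ * (1 + Λ) ^ 2 ≤ (1 - q) / 10000 := by
    have h1 : δ ≤ (1 - q) / (10000 * (1 + Λ) ^ 2) := (min_le_right _ _).trans (min_le_right _ _)
    rw [le_div_iff₀ (by positivity)] at h1
    linarith
  refine ⟨δ, hδ0, by linarith, fun K c hc hr hK => ?_⟩
  refine K.exists_eq_of_radialL2_eq (sub_eq_zero.1 (norm_eq_zero.1 ?_))
  set ε := ‖K.radialL2 - harmonicTerm n 0 K.radialL2‖ with hε
  have hε0 : 0 ≤ ε := norm_nonneg _
  have hc0 : 0 ≤ c := by linarith [hc.1]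
  have hεδ : ε ≤ δ := by
    refine (norm_sub_harmonicTerm_zero_le _ 1).trans ?_
    rw [SymConvexBody.radialL2, ← map_sub]
    refine norm_sphereToL2_le_of_forall fun θ => ?_
    change |K.radial θ - 1| ≤ δ
    rw [abs_le]
    constructor <;> linarith [hr θ]
  have hsupp : ∀ θ, 1 - δ ≤ K.supp θ ∧ K.supp θ ≤ 1 + δ := fun θ =>
    ⟨(hr θ).1.trans (K.radial_le_supp θ),
      K.supp_le_of_radial_le (by linarith) (fun θ => (hr θ).2) θ⟩
  set κ := ∫ θ, (⟨K.supp, K.continuous_supp⟩ : C(USphere n, ℝ)) θ ∂(sphereMeasure n) with hκ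
  have hκδ : κ ∈ Set.Icc (1 - δ) (1 + δ) := integral_mem_Icc_of_forall hsupp
  have hκL2 : harmonicTerm n 0 K.suppL2 = sphereToL2 n (ContinuousMap.const _ κ) :=
    harmonicTerm_zero_sphereToL2 _
  obtain ⟨g0, hg0V, hg0, hg0q⟩ := hN (K.radialL2 - harmonicTerm n 0 K.radialL2)
  rw [← hε] at hg0 hg0q
  obtain ⟨g, hg, hg1, hg2⟩ := hΛ (c • g0) (Submodule.smul_mem _ _ hg0V)
  have hgn : ‖c • g0‖ ≤ c * (q * ε) := by
    rw [norm_smul, Real.norm_of_nonneg hc0]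
    gcongr
  have hc2 : c ≤ 2 := by linarith [hc.2]
  have hgn2 : ‖c • g0‖ ≤ 2 * ε := by
    refine hgn.trans ?_
    have : q * ε ≤ ε := mul_le_of_le_one_left hε0 hq1.le
    have : 0 ≤ q * ε := by positivity
    nlinarith
  have hΛε : Λ * ‖c • g0‖ ≤ 2 * Λ * ε := by nlinarith
  have hΛδ : Λ * δ ≤ (1 - q) / 10000 := by nlinarith
  have hΛ' : Λ * ‖c • g0‖ ≤ 1 / 8 := by nlinarith
  have hmain := key K κ (Λ * ‖c • g0‖) g (by linarith [hκδ.1]) (by linarith [hκδ.2])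
    (by positivity) hΛ' hg1 hg2 (fun θ => ⟨by linarith [(hr θ).1], by linarith [(hr θ).2]⟩)
    (fun θ => by
      have h1 := abs_le.1 (hg1 θ)
      rw [abs_le]
      constructor <;> linarith [hsupp θ, hκδ.1, hκδ.2])
  rw [hg, ← hκL2] at hmain
  have hE : ‖K.suppL2 - harmonicTerm n 0 K.suppL2 - c • g0‖ ≤ δ * ε + 2 * (η * ε) := by
    have h1 : K.suppL2 - harmonicTerm n 0 K.suppL2 - c • g0 =
        ((K.suppL2 - harmonicTerm n 0 K.suppL2) -
          c • M (K.radialL2 - harmonicTerm n 0 K.radialL2)) +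
        c • (M (K.radialL2 - harmonicTerm n 0 K.radialL2) - g0) := by
      rw [smul_sub]; abel
    rw [h1]
    refine (norm_add_le _ _).trans (add_le_add hK ?_)
    rw [norm_smul, Real.norm_of_nonneg hc0]
    exact mul_le_mul hc2 hg0 (norm_nonneg _) (by norm_num)
  have hfin : ε ≤ ‖K.radialL2 - harmonicTerm n 0 K.suppL2 - c • g0‖ + ‖c • g0‖ := by
    refine (norm_sub_harmonicTerm_zero_le _ κ).trans ?_
    rw [← hκL2]
    have := norm_add_le (K.radialL2 - harmonicTerm n 0 K.suppL2 - c • g0) (c • g0)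
    rwa [sub_add_cancel] at this
  have hCE : C * ‖K.suppL2 - harmonicTerm n 0 K.suppL2 - c • g0‖ ≤ 3 * ((1 - q) / 16) * ε := by
    calc _ ≤ C * (δ * ε + 2 * (η * ε)) := by gcongr
      _ ≤ C * (η * ε + 2 * (η * ε)) := by gcongr
      _ = 3 * (C * η) * ε := by ring
      _ ≤ _ := by gcongr
  have hquad : 288 * (Λ * ‖c • g0‖) ^ 2 ≤ (1 - q) / 4 * ε := by
    calc 288 * (Λ * ‖c • g0‖) ^ 2 ≤ 288 * (2 * Λ * ε) ^ 2 := by gcongr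
      _ = 1152 * (Λ ^ 2 * ε) * ε := by ring
      _ ≤ 1152 * ((1 + Λ) ^ 2 * δ) * ε := by
        have h1 : Λ ^ 2 ≤ (1 + Λ) ^ 2 := by gcongr; linarith
        have h2 : Λ ^ 2 * ε ≤ (1 + Λ) ^ 2 * δ := mul_le_mul h1 hεδ hε0 (by positivity)
        exact mul_le_mul_of_nonneg_right (by linarith) hε0
      _ ≤ _ := mul_le_mul_of_nonneg_right (by linarith) hε0
  have hcq : c * (q * ε) ≤ (q + (1 - q) / 16) * ε := by
    have h1 : c * q ≤ q + (1 - q) / 16 := by nlinarith [hc.2]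
    calc c * (q * ε) = c * q * ε := by ring
      _ ≤ _ := by gcongr
  -- The three contributions are 3/16, 4/16 and 1/16 of (1 - q)ε on top of qε, so half of the gap
  -- remains.
  have hle : (1 - q) * ε ≤ 0 := by linarith
  exact le_antisymm (nonpos_of_mul_nonpos_right hle hq) hε0
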